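/- Consider rational linear recurrence sequences $(u_n)_{n\ge 0}$ of order $k\ge 2$, given by rationals $\alpha_1,\dots,\alpha_k$ and $\beta_0,\dots,\beta_{k-1}$ (written in binary as fractions of coprime integers) through $u_j=\beta_j$ for $0\le j<k$ and $u_{n+k}=\alpha_1u_{n+k-1}+\dots+\alpha_ku_n$ for all $n\ge 0$. The Positivity problem asks whether $u_n\ge 0$ for all $n$; it is not distinguished from its complement, which asks whether $u_n<0$ for some $n$. A weighted Markov decision process (MDP) $\mathcal M$ consists of finite sets $S$ of states and $\mathit{Act}$ of actions, transition probabilities $P\colon S\times \mathit{Act}\times S\to[0,1]\cap\mathbb Q$ with $\sum_{t}P(s,\alpha,t)\in\{0,1\}$ for all $(s,\alpha)$ (the action $\alpha$ is enabled in $s$ if this sum is $1$), an initial state from which all states are reachable, and weights $\mathit{wgt}\colon S\times \mathit{Act}\to\mathbb Z$. A scheduler assigns to each finite path whose last state has an enabled action a probability distribution over the actions enabled in that state; it induces a probability measure on the maximal (infinite, or finite and ending in a state without enabled actions) paths from the initial state. Let $\Pr^{\max}_{\mathcal M}$ and $\Pr^{\min}_{\mathcal M}$ be the supremum and the infimum of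 the probability of an event over all schedulers. The energy objective $\Box(\text{accumulated weight}\ge 0)$ is the event that every finite prefix of the path has non-negative accumulated weight. **Corollary.** The Positivity problem is reducible in polynomial time to each of the following two problems. Given a weighted MDP $\mathcal M$ and a rational $\vartheta\in(0,1)$ (with the numerical data in binary): 1. decide whether $\Pr^{\max}_{\mathcal M}(\Box(\text{accumulated weight}\ge 0))>\vartheta$; 2. decide whether $\Pr^{\min}_{\mathcal M}(\Box(\text{accumulated weight}\ge 0))<\vartheta$. More precisely, for each of the two problems there is a polynomial-time computable map from the data $(\alpha_1,\dots,\alpha_k,\beta_0,\dots,\beta_{k-1})$ to pairs $(\mathcal M,\vartheta)$ such that $u_n<0$ for some $n$ if and only if $(\mathcal M,\vartheta)$ is a yes-instance. -/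

import Mathlib

open MeasureTheory ProbabilityTheory
open scoped ENNReal

/-! ### Polynomial-time computation

The model is the random access machine with the logarithmic cost criterion: registers and array
cells hold integers, the basic operations are `+`, `-`, `*`, integer division and indirect
addressing, and every value that is read, computed or used as an address is charged by its binary
length. Control flow is structured (sequence, conditional, loop). Inputs and outputs are finite
lists of integers written in binary. -/

namespace LogRAM

/-- Binary length of an integer, including one bit for the sign. -/
def bitLength (z : ℤ) : ℕ := Nat.size z.natAbs + 1

/-- Total binary length of a list of integers. -/
def listSize (l : List ℤ) : ℕ := (l.map bitLength).sum

/-- Machine states: integer registers, integer arrays, and the output list written so far. -/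
structure State where
  reg : ℕ → ℤ
  mem : ℕ → ℤ → ℤ
  out : List ℤ

/-- Arithmetic expressions; `get a e` reads the cell of array `a` with address `e`. -/
inductive Expr : Type
  | const (c : ℤ)
  | var (x : ℕ)
  | get (a : ℕ) (e : Expr)
  | add (e₁ e₂ : Expr)
  | sub (e₁ e₂ : Expr)
  | mul (e₁ e₂ : Expr)
  | div (e₁ e₂ : Expr)

namespace Expr

def eval (σ : State) : Expr → ℤ
  | const c => c
  | var x => σ.reg x
  | get a e => σ.mem a (e.eval σ)
  | add e₁ e₂ => e₁.eval σ + e₂.eval σ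
  | sub e₁ e₂ => e₁.eval σ - e₂.eval σ
  | mul e₁ e₂ => e₁.eval σ * e₂.eval σ
  | div e₁ e₂ => e₁.eval σ / e₂.eval σ

/-- Logarithmic cost of an evaluation: the sum of the binary lengths of the values of all
subexpressions, hence of all operands, addresses and results. -/
def cost (σ : State) : Expr → ℕ
  | const c => bitLength c
  | var x => bitLength (σ.reg x)
  | get a e => e.cost σ + bitLength (σ.mem a (e.eval σ))
  | add e₁ e₂ => e₁.cost σ + e₂.cost σ + bitLength (e₁.eval σ + e₂.eval σ)
  | sub e₁ e₂ => e₁.cost σ + e₂.cost σ + bitLength (e₁.eval σ - e₂.eval σ)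
  | mul e₁ e₂ => e₁.cost σ + e₂.cost σ + bitLength (e₁.eval σ * e₂.eval σ)
  | div e₁ e₂ => e₁.cost σ + e₂.cost σ + bitLength (e₁.eval σ / e₂.eval σ)

end Expr

/-- Programs. `store a i e` writes `e` to the cell of array `a` with address `i`; `emit e` appends
`e` to the output; `ifPos e c d` runs `c` if `0 < e` and `d` otherwise; `loopPos e c` runs `c` as
long as `0 < e`. -/
inductive Prog : Type
  | skip
  | assign (x : ℕ) (e : Expr)
  | store (a : ℕ) (i e : Expr)
  | emit (e : Expr)
  | seq (c d : Prog)
  | ifPos (e : Expr) (c d : Prog)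
  | loopPos (e : Expr) (c : Prog)

/-- `Run c σ τ t`: started in state `σ`, the program `c` halts in state `τ` with total cost `t`. -/
inductive Run : Prog → State → State → ℕ → Prop
  | skip (σ : State) : Run .skip σ σ 1
  | assign (σ : State) (x : ℕ) (e : Expr) :
      Run (.assign x e) σ { σ with reg := Function.update σ.reg x (e.eval σ) } (e.cost σ + 1)
  | store (σ : State) (a : ℕ) (i e : Expr) :
      Run (.store a i e) σ
        { σ with mem :=
            Function.update σ.mem a (Function.update (σ.mem a) (i.eval σ) (e.eval σ)) }
        (i.cost σ + e.cost σ + 1)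
  | emit (σ : State) (e : Expr) :
      Run (.emit e) σ { σ with out := σ.out ++ [e.eval σ] } (e.cost σ + 1)
  | seq {c d : Prog} {σ τ ρ : State} {t u : ℕ} :
      Run c σ τ t → Run d τ ρ u → Run (.seq c d) σ ρ (t + u)
  | ifPos {e : Expr} {c d : Prog} {σ τ : State} {t : ℕ} :
      0 < e.eval σ → Run c σ τ t → Run (.ifPos e c d) σ τ (e.cost σ + 1 + t)
  | ifNonpos {e : Expr} {c d : Prog} {σ τ : State} {t : ℕ} :
      e.eval σ ≤ 0 → Run d σ τ t → Run (.ifPos e c d) σ τ (e.cost σ + 1 + t)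
  | loopStop {e : Expr} {c : Prog} {σ : State} :
      e.eval σ ≤ 0 → Run (.loopPos e c) σ σ (e.cost σ + 1)
  | loopStep {e : Expr} {c : Prog} {σ τ ρ : State} {t u : ℕ} :
      0 < e.eval σ → Run c σ τ t → Run (.loopPos e c) τ ρ u →
        Run (.loopPos e c) σ ρ (e.cost σ + 1 + t + u)

/-- Initial state on input `l`: register `0` holds the length of `l`, the cells
`0, …, l.length - 1` of array `0` hold the entries of `l`, and all else is `0`. -/
def initState (l : List ℤ) : State where
  reg x := if x = 0 then l.length else 0
  mem a i := if a = 0 ∧ 0 ≤ i then l.getD i.toNat 0 else 0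
  out := []

/-- `f` is computable in polynomial time with respect to the encodings `encA` and `encB`. -/
def PolyTimeComputable {A B : Type} (encA : A → List ℤ) (encB : B → List ℤ) (f : A → B) : Prop :=
  ∃ (c : Prog) (p : Polynomial ℕ), ∀ a : A, ∃ (τ : State) (t : ℕ),
    Run c (initState (encA a)) τ t ∧ τ.out = encB (f a) ∧ t ≤ p.eval (listSize (encA a))

end LogRAM

/-- A decision problem: instances, their encoding, and the set of yes-instances. -/
structure DecisionProblem where
  Instance : Type
  encode : Instance → List ℤ
  yes : Set Instance

namespace DecisionProblem

/-- The complementary decision problem. -/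
def compl (A : DecisionProblem) : DecisionProblem where
  Instance := A.Instance
  encode := A.encode
  yes := A.yesᶜ

/-- Polynomial-time many-one reducibility. -/
def PolyTimeReducible (A B : DecisionProblem) : Prop :=
  ∃ f : A.Instance → B.Instance,
    LogRAM.PolyTimeComputable A.encode B.encode f ∧ ∀ a, a ∈ A.yes ↔ f a ∈ B.yes

end DecisionProblem

/-- A rational number is encoded as a fraction of coprime integers. -/
def encodeRat (q : ℚ) : List ℤ := [q.num, (q.den : ℤ)]

/-! ### The Positivity problem -/

/-- A rational linear recurrence sequence of order at least two, given by the coefficients of the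
recurrence and the initial values. -/
structure LRSInstance where
  recurrence : LinearRecurrence ℚ
  two_le_order : 2 ≤ recurrence.order
  initial : Fin recurrence.order → ℚ

namespace LRSInstance

/-- The `n`-th member of the sequence. -/
def term (I : LRSInstance) (n : ℕ) : ℚ := I.recurrence.mkSol I.initial n

/-- The order, the coefficients and the initial values. -/
def encode (I : LRSInstance) : List ℤ :=
  (I.recurrence.order : ℤ) ::
    ((List.finRange I.recurrence.order).flatMap (fun i => encodeRat (I.recurrence.coeffs i)) ++
      (List.finRange I.recurrence.order).flatMap (fun i => encodeRat (I.initial i)))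

end LRSInstance

/-- The Positivity problem: are all members of the sequence non-negative? -/
def positivityProblem : DecisionProblem where
  Instance := LRSInstance
  encode := LRSInstance.encode
  yes := {I | ∀ n, 0 ≤ I.term n}

/-! ### Weighted Markov decision processes -/

/-- One step of a trajectory: the action by which the current state was entered (`none` at time `0`
and after the process has stopped in a trap state) and the current state. -/
structure MDPStep (S Act : Type) where
  action : Option Act
  state : S

namespace MDPStep

instance (S Act : Type) : MeasurableSpace (MDPStep S Act) := ⊤

instance (S Act : Type) [Countable S] [Countable Act] : Countable (MDPStep S Act) :=
  Function.Injective.countable (f := fun x : MDPStep S Act => (x.action, x.state))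
    (fun x y h => by cases x; cases y; simp_all)

end MDPStep

/-- A Markov decision process with rational transition probabilities and integer weights in which
all states are reachable from the initial state. -/
structure WeightedMDP (S Act : Type) [Fintype S] where
  prob : S → Act → S → ℚ
  prob_nonneg : ∀ s α t, 0 ≤ prob s α t
  prob_sum : ∀ s α, ∑ t, prob s α t = 0 ∨ ∑ t, prob s α t = 1
  init : S
  reachable : ∀ s, Relation.ReflTransGen (fun s t => ∃ α, 0 < prob s α t) init s
  wgt : S → Act → ℤ

namespace WeightedMDP

variable {S Act : Type} [Fintype S] [Fintype Act] (M : WeightedMDP S Act)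

/-- The actions enabled in the state `s`. The state is a trap state if there are none. -/
def EnabledAct (s : S) : Type := {α : Act // ∑ t, M.prob s α t = 1}

/-- The distribution of the next state when an enabled action is taken. -/
noncomputable def next (s : S) (α : M.EnabledAct s) : PMF S :=
  PMF.ofFintype (fun t => ENNReal.ofReal (M.prob s α.1 t : ℝ)) (by
    rw [← ENNReal.ofReal_sum_of_nonneg (fun t _ => by exact_mod_cast M.prob_nonneg s α.1 t)]
    have h : ∑ t, (M.prob s α.1 t : ℝ) = 1 := by exact_mod_cast α.2
    rw [h, ENNReal.ofReal_one])

/-- The history of a trajectory up to time `n`. -/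
abbrev History (S Act : Type) (n : ℕ) : Type := (i : Finset.Iic n) → MDPStep S Act

/-- The last state of a history. -/
def History.last {S Act : Type} {n : ℕ} (h : History S Act n) : S :=
  (h ⟨n, Finset.mem_Iic.2 le_rfl⟩).state

/-- A randomized history-dependent scheduler: it assigns to each history that does not end in a
trap state a probability distribution over the actions enabled in its last state. -/
def Scheduler : Type :=
  ∀ (n : ℕ) (h : History S Act n), Nonempty (M.EnabledAct h.last) → PMF (M.EnabledAct h.last)

open Classical in
/-- The distribution of the next step after the history `h`. In a trap state the process stops: the
finite maximal path is continued by repeating the state without an action. -/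
noncomputable def stepPMF (𝔖 : M.Scheduler) (n : ℕ) (h : History S Act n) : PMF (MDPStep S Act) :=
  if hne : Nonempty (M.EnabledAct h.last) then
    (𝔖 n h hne).bind fun α => (M.next h.last α).map fun t => ⟨some α.1, t⟩
  else PMF.pure ⟨none, h.last⟩

/-- The distribution of the next step as a Markov kernel. -/
noncomputable def stepKernel (𝔖 : M.Scheduler) (n : ℕ) :
    Kernel (History S Act n) (MDPStep S Act) :=
  Kernel.ofFunOfCountable fun h => (M.stepPMF 𝔖 n h).toMeasure

instance (𝔖 : M.Scheduler) (n : ℕ) : IsMarkovKernel (M.stepKernel 𝔖 n) :=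
  ⟨fun h => inferInstanceAs (IsProbabilityMeasure (M.stepPMF 𝔖 n h).toMeasure)⟩

/-- The history of length `0` that consists of the initial state. -/
def start : History S Act 0 := fun _ => ⟨none, M.init⟩

/-- The probability measure on trajectories from the initial state induced by a scheduler. -/
noncomputable def pathMeasure (𝔖 : M.Scheduler) : Measure (ℕ → MDPStep S Act) :=
  Kernel.traj (X := fun _ => MDPStep S Act) (M.stepKernel 𝔖) 0 M.start

/-- The weight accumulated in the first `n` steps; stopped steps have weight `0`. -/
def accumulatedWeight (ω : ℕ → MDPStep S Act) (n : ℕ) : ℤ :=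
  ∑ i ∈ Finset.range n,
    match (ω (i + 1)).action with
    | none => 0
    | some α => M.wgt (ω i).state α

/-- The energy objective: the accumulated weight of every prefix is non-negative. -/
def energyObjective : Set (ℕ → MDPStep S Act) := {ω | ∀ n, 0 ≤ M.accumulatedWeight ω n}

/-- Maximal probability of an event over all schedulers. -/
noncomputable def prMax (E : Set (ℕ → MDPStep S Act)) : ℝ≥0∞ :=
  ⨆ 𝔖 : M.Scheduler, M.pathMeasure 𝔖 E

/-- Minimal probability of an event over all schedulers. -/
noncomputable def prMin (E : Set (ℕ → MDPStep S Act)) : ℝ≥0∞ :=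
  ⨅ 𝔖 : M.Scheduler, M.pathMeasure 𝔖 E

end WeightedMDP

/-! ### The threshold problems for energy objectives -/

/-- A weighted Markov decision process, with states and actions numbered, and a rational threshold
in `(0, 1)`. -/
structure ThresholdInstance where
  numStates : ℕ
  numActions : ℕ
  mdp : WeightedMDP (Fin numStates) (Fin numActions)
  threshold : ℚ
  threshold_pos : 0 < threshold
  threshold_lt_one : threshold < 1

namespace ThresholdInstance

/-- The numbers of states and actions, the initial state, the tables of weights and of transition
probabilities, and the threshold. -/
def encode (J : ThresholdInstance) : List ℤ :=
  [(J.numStates : ℤ), (J.numActions : ℤ), (J.mdp.init.val : ℤ)] ++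
    (List.finRange J.numStates).flatMap (fun s =>
      (List.finRange J.numActions).flatMap (fun α =>
        J.mdp.wgt s α ::
          (List.finRange J.numStates).flatMap (fun t => encodeRat (J.mdp.prob s α t)))) ++
    encodeRat J.threshold

end ThresholdInstance

/-- Is the maximal probability of the energy objective greater than the threshold? -/
noncomputable def maxEnergyProblem : DecisionProblem where
  Instance := ThresholdInstance
  encode := ThresholdInstance.encode
  yes := {J | ENNReal.ofReal (J.threshold : ℝ) < J.mdp.prMax J.mdp.energyObjective}

/-- Is the minimal probability of the energy objective less than the threshold? -/
noncomputable def minEnergyProblem : DecisionProblem where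
  Instance := ThresholdInstance
  encode := ThresholdInstance.encode
  yes := {J | J.mdp.prMin J.mdp.energyObjective < ENNReal.ofReal (J.threshold : ℝ)}

/-! Divide the companion matrix and the initial values of the recurrence by a number so large that
the resulting entries `A i j` and `b i` have modulus less than 1. The process has a counter, in
which every step gains weight 1, a trap, a state that only leads to the trap, and a positive and a
negative copy of each of the `k` components of the recurrence vector. Every step outside the counter
costs 1. The copy of `i` with sign `σ` moves to the copy of `j` with sign `τ` with probability `(1 +
στ A i j) / (4k)`, to the trap with probability `(1 + σ b i) / 4`, and to the penultimate state with
probability `(1 - σ b i) / 4`.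

Outside the counter there is no choice. Induction on the weight shows that from the copy of `i` with
sign `σ` and weight `n ≥ 1` the objective has probability `(2 - 3/2^n + σ v i (n-1)) / 2`, where `v`
starts at `b/2` and is multiplied by `A/(2k)` in each step (`vec_succ`, `sum_entry_mul_value`). The
mean over the two copies does not depend on the sequence, their difference is `v i (n-1)`, and `v 0
m` is a positive multiple of `u m`.

In the counter, both actions stay with probability 1/2. Otherwise, the first action chooses evenly
between the two copies of component 0, and the second goes to one fixed copy. Using only the first
action gives probability `1 - 1/2^(n+1)` from weight `n`, thus 1/2 at the start. The second action
at weight `n` changes this by `± v 0 n / 4`, with the sign given by the copy. If no `u n` is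
negative, the second action can thus only change the probability in one direction, and no scheduler
crosses 1/2 in the other. If `u n < 0`, taking the second action exactly at weight `n` crosses it by
a multiple of `u n / 2^n`. The negative copy serves for the maximum, the positive one for the
minimum.

The probabilities are certified by functions of state and weight. A subharmonic function bounded by
1 is a lower bound (`le_pathMeasure_of_subharmonic`). A superharmonic function is an upper bound
provided that the mass not yet absorbed vanishes geometrically (`pathMeasure_le_of_superharmonic`).
It then suffices to check one step for each enabled action, which covers all randomized
history-dependent schedulers.

For the running time, an explicit program tabulates the transition probabilities. A loop-free
program lengthens numbers by a constant factor only (`LoopFree.run`), the table has polynomially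
many entries, and lowest terms are obtained by Euclid's algorithm, whose number of rounds is linear
in the bit length (`euclid_reaches`). -/

set_option linter.unusedSectionVars false

/-! ### Expectations under discrete distributions -/

theorem PMF.lintegral_toMeasure_eq_tsum {A : Type} [Countable A] (p : PMF A) (F : A → ℝ≥0∞) :
    ∫⁻ a, F a ∂(@PMF.toMeasure A ⊤ p) = ∑' a, p a * F a := by
  let _ : MeasurableSpace A := ⊤
  have : MeasurableSingletonClass A := ⟨fun _ => trivial⟩
  rw [lintegral_countable']
  refine tsum_congr fun a => ?_
  rw [PMF.toMeasure_apply_singleton _ _ (measurableSet_singleton a), mul_comm]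

theorem PMF.tsum_bind_mul {A B : Type} (p : PMF A) (q : A → PMF B) (F : B → ℝ≥0∞) :
    ∑' b, p.bind q b * F b = ∑' a, p a * ∑' b, q a b * F b := by
  simp_rw [PMF.bind_apply, ← ENNReal.tsum_mul_right]
  rw [ENNReal.tsum_comm]
  refine tsum_congr fun a => ?_
  rw [← ENNReal.tsum_mul_left]
  exact tsum_congr fun b => mul_assoc _ _ _

theorem PMF.tsum_map_mul {A B : Type} (p : PMF A) (g : A → B) (F : B → ℝ≥0∞) :
    ∑' b, p.map g b * F b = ∑' a, p a * F (g a) := by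
  classical
  rw [PMF.map, PMF.tsum_bind_mul]
  refine tsum_congr fun a => ?_
  rw [tsum_eq_single (g a)]
  · simp
  · intro b hb
    simp [hb]

theorem PMF.tsum_mul_le {A : Type} (p : PMF A) (X : A → ℝ≥0∞) (c : ℝ≥0∞)
    (h : ∀ a ∈ p.support, X a ≤ c) : ∑' a, p a * X a ≤ c := by
  calc ∑' a, p a * X a ≤ ∑' a, p a * c := by
        refine ENNReal.tsum_le_tsum fun a => ?_
        by_cases ha : a ∈ p.support
        · exact mul_le_mul_right (h a ha) _
        · simp [(p.apply_eq_zero_iff a).2 ha]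
    _ = c := by rw [ENNReal.tsum_mul_right, p.tsum_coe, one_mul]

theorem PMF.le_tsum_mul {A : Type} (p : PMF A) (X : A → ℝ≥0∞) (c : ℝ≥0∞)
    (h : ∀ a ∈ p.support, c ≤ X a) : c ≤ ∑' a, p a * X a := by
  calc c = ∑' a, p a * c := by rw [ENNReal.tsum_mul_right, p.tsum_coe, one_mul]
    _ ≤ ∑' a, p a * X a := by
        refine ENNReal.tsum_le_tsum fun a => ?_
        by_cases ha : a ∈ p.support
        · exact mul_le_mul_right (h a ha) _
        · simp [(p.apply_eq_zero_iff a).2 ha]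

/-! ### Harmonic-type functions as bounds on the probability of an energy objective -/

namespace WeightedMDP

variable {S Act : Type} [Fintype S] [Fintype Act] (M : WeightedMDP S Act)

/-- The trajectory that follows a history and then stays in its last step. -/
def History.extend {n : ℕ} (h : History S Act n) : ℕ → MDPStep S Act :=
  fun i => h ⟨min i n, Finset.mem_Iic.2 (min_le_right i n)⟩

/-- The history `h` followed by the step `y`. -/
def History.snoc {n : ℕ} (h : History S Act n) (y : MDPStep S Act) : History S Act (n + 1) :=
  fun i => if hi : i.1 ≤ n then h ⟨i.1, Finset.mem_Iic.2 hi⟩ else y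

theorem History.extend_self {n : ℕ} (h : History S Act n) : (h.extend n).state = h.last := by
  simp [History.extend, History.last]

theorem History.extend_snoc_of_le {n : ℕ} (h : History S Act n) (y : MDPStep S Act) {i : ℕ}
    (hi : i ≤ n) : (h.snoc y).extend i = h.extend i := by
  have h1 : min i (n + 1) ≤ n := by omega
  simp only [History.extend, History.snoc, h1, dite_true]
  congr 2
  omega

theorem History.extend_snoc_succ {n : ℕ} (h : History S Act n) (y : MDPStep S Act) :
    (h.snoc y).extend (n + 1) = y := by
  simp [History.extend, History.snoc]

theorem History.last_snoc {n : ℕ} (h : History S Act n) (y : MDPStep S Act) :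
    (h.snoc y).last = y.state := by
  simp [History.last, History.snoc]

theorem accumulatedWeight_congr {ω ω' : ℕ → MDPStep S Act} {n : ℕ}
    (h : ∀ i ≤ n, ω i = ω' i) : M.accumulatedWeight ω n = M.accumulatedWeight ω' n := by
  refine Finset.sum_congr rfl fun i hi => ?_
  have hi := Finset.mem_range.1 hi
  rw [h i (by omega), h (i + 1) (by omega)]

/-- The weight accumulated along a history. -/
def historyWeight {n : ℕ} (h : History S Act n) : ℤ := M.accumulatedWeight h.extend n

/-- The accumulated weight is non-negative along all prefixes of a history. -/
def historySafe {n : ℕ} (h : History S Act n) : Prop :=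
  ∀ m ≤ n, 0 ≤ M.accumulatedWeight h.extend m

/-- The weight of a step that leaves the state `s` by the action `a`. -/
def stepWeight (s : S) : Option Act → ℤ
  | none => 0
  | some α => M.wgt s α

theorem historyWeight_snoc {n : ℕ} (h : History S Act n) (y : MDPStep S Act) :
    M.historyWeight (h.snoc y) = M.historyWeight h + M.stepWeight h.last y.action := by
  unfold historyWeight
  rw [accumulatedWeight, Finset.sum_range_succ]
  congr 1
  · exact M.accumulatedWeight_congr fun i hi => h.extend_snoc_of_le y hi
  · rw [h.extend_snoc_of_le y le_rfl, h.extend_snoc_succ, h.extend_self]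
    rfl

theorem historySafe_snoc {n : ℕ} (h : History S Act n) (y : MDPStep S Act) :
    M.historySafe (h.snoc y) ↔ M.historySafe h ∧ 0 ≤ M.historyWeight (h.snoc y) := by
  constructor
  · intro H
    refine ⟨fun m hm => ?_, H (n + 1) le_rfl⟩
    have := H m (by omega)
    rwa [M.accumulatedWeight_congr fun i hi => h.extend_snoc_of_le y (hi.trans hm)] at this
  · rintro ⟨H, H'⟩ m hm
    rcases Nat.lt_or_ge n m with hlt | hle
    · obtain rfl : m = n + 1 := by omega
      exact H'
    · rw [M.accumulatedWeight_congr fun i hi => h.extend_snoc_of_le y (hi.trans hle)]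
      exact H m hle

/-- The distribution of the first `n` steps. -/
noncomputable def historyMeasure (𝔖 : M.Scheduler) (n : ℕ) : Measure (History S Act n) :=
  Kernel.partialTraj (X := fun _ => MDPStep S Act) (M.stepKernel 𝔖) 0 n M.start

theorem lintegral_historyMeasure_zero (𝔖 : M.Scheduler) (F : History S Act 0 → ℝ≥0∞) :
    ∫⁻ h, F h ∂(M.historyMeasure 𝔖 0) = F M.start := by
  unfold historyMeasure
  rw [Kernel.partialTraj_self, Kernel.lintegral_id' (measurable_of_countable F)]

/-- Tower property of the trajectory measure. It reduces the estimates over `n` steps to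
inequalities for a single step. -/
theorem lintegral_historyMeasure_succ (𝔖 : M.Scheduler) (n : ℕ)
    (F : History S Act (n + 1) → ℝ≥0∞) :
    ∫⁻ h, F h ∂(M.historyMeasure 𝔖 (n + 1)) =
      ∫⁻ h, ∫⁻ y, F (h.snoc y) ∂(M.stepPMF 𝔖 n h).toMeasure ∂(M.historyMeasure 𝔖 n) := by
  unfold historyMeasure
  have hF : Measurable F := measurable_of_countable F
  rw [Kernel.partialTraj_succ_of_le (Nat.zero_le n), Kernel.lintegral_map _ (by fun_prop) _ hF,
    Kernel.lintegral_comp _ _ _ (by fun_prop)]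
  refine lintegral_congr fun h => ?_
  rw [Kernel.lintegral_id_prod (by fun_prop), Kernel.lintegral_map _ (by fun_prop) _ (by fun_prop)]
  change ∫⁻ y, _ ∂(M.stepPMF 𝔖 n h).toMeasure = _
  refine lintegral_congr fun y => congrArg F (funext fun i => ?_)
  simp only [IicProdIoc, History.snoc]
  split_ifs with hi
  · rfl
  · obtain ⟨i, hi'⟩ := i
    obtain rfl : i = n + 1 := le_antisymm (Finset.mem_Iic.1 hi') (not_le.1 hi)
    rfl

/-- The event depends on the first `n` steps only, so the marginal of the trajectory measure decides
it. -/
theorem pathMeasure_prefix (𝔖 : M.Scheduler) (n : ℕ) :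
    M.pathMeasure 𝔖 {ω | ∀ m ≤ n, 0 ≤ M.accumulatedWeight ω m} =
      M.historyMeasure 𝔖 n {h | M.historySafe h} := by
  unfold historyMeasure pathMeasure
  rw [← Kernel.traj_map_frestrictLe, Kernel.map_apply' _ (by fun_prop) _
    (Set.to_countable _).measurableSet]
  congr 1
  ext ω
  refine forall₂_congr fun m hm => ?_
  rw [M.accumulatedWeight_congr]
  intro i hi
  simp [History.extend, min_eq_left (hi.trans hm)]

open Classical in
/-- The value `V` of the current state and the accumulated weight as long as the accumulated weight
has been non-negative, and `0` afterwards. -/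
noncomputable def safeValue (V : S → ℤ → ℝ≥0∞) {n : ℕ} (h : History S Act n) : ℝ≥0∞ :=
  if M.historySafe h then V h.last (M.historyWeight h) else 0

/-- The expectation of `V` after the action `α` is taken. -/
noncomputable def expectedValue (V : S → ℤ → ℝ≥0∞) (s : S) (w : ℤ) (α : Act) : ℝ≥0∞ :=
  ∑ t, ENNReal.ofReal (M.prob s α t : ℝ) * V t (w + M.wgt s α)

/-- Because `V` vanishes at negative weights, a step that violates the objective needs no separate
case. -/
theorem safeValue_snoc (V : S → ℤ → ℝ≥0∞) (hV : ∀ s w, w < 0 → V s w = 0) {n : ℕ}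
    (h : History S Act n) (hs : M.historySafe h) (y : MDPStep S Act) :
    M.safeValue V (h.snoc y) = V y.state (M.historyWeight h + M.stepWeight h.last y.action) := by
  unfold safeValue
  rw [historySafe_snoc, h.last_snoc, historyWeight_snoc]
  split_ifs with H
  · rfl
  · exact (hV _ _ (not_le.1 fun H' => H ⟨hs, H'⟩)).symm

theorem safeValue_snoc_of_not_safe (V : S → ℤ → ℝ≥0∞) {n : ℕ}
    (h : History S Act n) (hs : ¬ M.historySafe h) (y : MDPStep S Act) :
    M.safeValue V (h.snoc y) = 0 := by
  unfold safeValue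
  rw [historySafe_snoc, if_neg fun H => hs H.1]

/-- The one-step expectation is an average over the scheduler's choice of action. A bound for each
action in its support is therefore a bound for the randomized choice. -/
theorem lintegral_step_of_enabled (𝔖 : M.Scheduler) (V : S → ℤ → ℝ≥0∞)
    (hV : ∀ s w, w < 0 → V s w = 0) {n : ℕ} (h : History S Act n) (hs : M.historySafe h)
    (hne : Nonempty (M.EnabledAct h.last)) :
    ∫⁻ y, M.safeValue V (h.snoc y) ∂(M.stepPMF 𝔖 n h).toMeasure =
      ∑' α, 𝔖 n h hne α * M.expectedValue V h.last (M.historyWeight h) α.1 := by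
  rw [PMF.lintegral_toMeasure_eq_tsum, stepPMF, dif_pos hne, PMF.tsum_bind_mul]
  refine tsum_congr fun α => ?_
  rw [PMF.tsum_map_mul, tsum_fintype]
  congr 1
  refine Finset.sum_congr rfl fun t _ => ?_
  rw [M.safeValue_snoc V hV h hs]
  rfl

theorem lintegral_step_of_trap (𝔖 : M.Scheduler) (V : S → ℤ → ℝ≥0∞)
    (hV : ∀ s w, w < 0 → V s w = 0) {n : ℕ} (h : History S Act n) (hs : M.historySafe h)
    (hne : ¬ Nonempty (M.EnabledAct h.last)) :
    ∫⁻ y, M.safeValue V (h.snoc y) ∂(M.stepPMF 𝔖 n h).toMeasure =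
      V h.last (M.historyWeight h) := by
  classical
  rw [PMF.lintegral_toMeasure_eq_tsum, stepPMF, dif_neg hne, tsum_eq_single ⟨none, h.last⟩]
  · rw [M.safeValue_snoc V hV h hs]
    simp [stepWeight]
  · intro b hb
    simp [hb]

theorem safeValue_of_not_safe (V : S → ℤ → ℝ≥0∞) {n : ℕ} {h : History S Act n}
    (hs : ¬ M.historySafe h) : M.safeValue V h = 0 := if_neg hs

theorem safeValue_of_safe (V : S → ℤ → ℝ≥0∞) {n : ℕ} {h : History S Act n}
    (hs : M.historySafe h) : M.safeValue V h = V h.last (M.historyWeight h) := if_pos hs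

theorem historySafe.weight_nonneg {n : ℕ} {h : History S Act n} (hs : M.historySafe h) :
    0 ≤ M.historyWeight h := hs n le_rfl

theorem start_safe : M.historySafe M.start := by
  intro m hm
  obtain rfl : m = 0 := by omega
  simp [accumulatedWeight]

theorem safeValue_start (V : S → ℤ → ℝ≥0∞) : M.safeValue V M.start = V M.init 0 := by
  rw [M.safeValue_of_safe V M.start_safe]
  rfl

/-- If `V` contracts by the factor `ρ` in expectation, then so does the expectation of `V`. -/
theorem lintegral_safeValue_le (𝔖 : M.Scheduler) (V : S → ℤ → ℝ≥0∞) (ρ : ℝ≥0∞)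
    (hV : ∀ s w, w < 0 → V s w = 0)
    (htrap : ∀ s w, ¬ Nonempty (M.EnabledAct s) → V s w ≤ ρ * V s w)
    (hstep : ∀ (n : ℕ) (h : History S Act n) (hne : Nonempty (M.EnabledAct h.last)),
      M.historySafe h → ∀ α ∈ (𝔖 n h hne).support,
        M.expectedValue V h.last (M.historyWeight h) α.1 ≤ ρ * V h.last (M.historyWeight h))
    (n : ℕ) : ∫⁻ h, M.safeValue V h ∂(M.historyMeasure 𝔖 n) ≤ ρ ^ n * V M.init 0 := by
  induction n with
  | zero => simp [lintegral_historyMeasure_zero, safeValue_start]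
  | succ n ih =>
    rw [lintegral_historyMeasure_succ]
    calc _ ≤ ∫⁻ h, ρ * M.safeValue V h ∂(M.historyMeasure 𝔖 n) := by
          refine lintegral_mono fun h => ?_
          by_cases hs : M.historySafe h
          · rw [M.safeValue_of_safe V hs]
            by_cases hne : Nonempty (M.EnabledAct h.last)
            · rw [M.lintegral_step_of_enabled 𝔖 V hV h hs hne]
              exact PMF.tsum_mul_le _ _ _ (hstep n h hne hs)
            · rw [M.lintegral_step_of_trap 𝔖 V hV h hs hne]
              exact htrap _ _ hne
          · simp [M.safeValue_snoc_of_not_safe V h hs]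
      _ = ρ * ∫⁻ h, M.safeValue V h ∂(M.historyMeasure 𝔖 n) :=
          lintegral_const_mul _ (measurable_of_countable _)
      _ ≤ ρ * (ρ ^ n * V M.init 0) := mul_le_mul_right ih _
      _ = _ := by ring

/-- If `V` does not decrease in expectation, then neither does the expectation of `V`. -/
theorem le_lintegral_safeValue (𝔖 : M.Scheduler) (V : S → ℤ → ℝ≥0∞)
    (hV : ∀ s w, w < 0 → V s w = 0)
    (hstep : ∀ (n : ℕ) (h : History S Act n) (hne : Nonempty (M.EnabledAct h.last)),
      M.historySafe h → ∀ α ∈ (𝔖 n h hne).support,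
        V h.last (M.historyWeight h) ≤ M.expectedValue V h.last (M.historyWeight h) α.1)
    (n : ℕ) : V M.init 0 ≤ ∫⁻ h, M.safeValue V h ∂(M.historyMeasure 𝔖 n) := by
  induction n with
  | zero => simp [lintegral_historyMeasure_zero, safeValue_start]
  | succ n ih =>
    rw [lintegral_historyMeasure_succ]
    refine ih.trans (lintegral_mono fun h => ?_)
    by_cases hs : M.historySafe h
    · rw [M.safeValue_of_safe V hs]
      by_cases hne : Nonempty (M.EnabledAct h.last)
      · rw [M.lintegral_step_of_enabled 𝔖 V hV h hs hne]
        exact PMF.le_tsum_mul _ _ _ (hstep n h hne hs)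
      · rw [M.lintegral_step_of_trap 𝔖 V hV h hs hne]
    · simp [M.safeValue_of_not_safe V hs]

/-- In this form, prefix probabilities can be compared pointwise with the expectation of a value
function. -/
theorem lintegral_safeValue_one (𝔖 : M.Scheduler) (n : ℕ) :
    ∫⁻ h, M.safeValue (fun _ _ => 1) h ∂(M.historyMeasure 𝔖 n) =
      M.pathMeasure 𝔖 {ω | ∀ m ≤ n, 0 ≤ M.accumulatedWeight ω m} := by
  classical
  rw [pathMeasure_prefix, ← lintegral_indicator_one (Set.to_countable _).measurableSet]
  refine lintegral_congr fun h => ?_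
  simp [safeValue, Set.indicator_apply]

theorem pathMeasure_energyObjective_le_prefix (𝔖 : M.Scheduler) (n : ℕ) :
    M.pathMeasure 𝔖 M.energyObjective ≤
      M.pathMeasure 𝔖 {ω | ∀ m ≤ n, 0 ≤ M.accumulatedWeight ω m} :=
  measure_mono fun _ h m _ => h m

/-- The energy objective is the decreasing intersection of its prefix events, and the measure is
finite, so continuity from above applies. -/
theorem le_pathMeasure_energyObjective (𝔖 : M.Scheduler) (c : ℝ≥0∞)
    (h : ∀ n, c ≤ M.pathMeasure 𝔖 {ω | ∀ m ≤ n, 0 ≤ M.accumulatedWeight ω m}) :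
    c ≤ M.pathMeasure 𝔖 M.energyObjective := by
  have hE : M.energyObjective = ⋂ n, {ω | ∀ m ≤ n, 0 ≤ M.accumulatedWeight ω m} := by
    ext ω
    simp only [energyObjective, Set.mem_ofPred_eq, Set.mem_iInter]
    exact ⟨fun h n m _ => h m, fun h n => h n n le_rfl⟩
  have : IsFiniteMeasure (M.pathMeasure 𝔖) := by
    unfold pathMeasure
    infer_instance
  rw [hE, Antitone.measure_iInter]
  · exact le_iInf h
  · intro a b hab ω hω m hm
    exact hω m (hm.trans hab)
  · intro n
    have hm : ∀ m, Measurable fun ω => M.accumulatedWeight ω m := by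
      intro m
      refine Finset.measurable_sum _ fun i _ => ?_
      have : Measurable fun p : MDPStep S Act × MDPStep S Act =>
          M.stepWeight p.1.state p.2.action := measurable_of_countable _
      have h2 : Measurable fun ω : ℕ → MDPStep S Act => (ω i, ω (i + 1)) :=
        (measurable_pi_apply i).prodMk (measurable_pi_apply (i + 1))
      exact this.comp h2
    have : MeasurableSet {ω | ∀ m ≤ n, 0 ≤ M.accumulatedWeight ω m} := by
      simp only [Set.ofPred_forall]
      exact MeasurableSet.iInter fun m => MeasurableSet.iInter fun _ =>
        measurableSet_le measurable_const (hm m)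
    exact this.nullMeasurableSet
  · exact ⟨0, measure_ne_top _ _⟩

/-- A bounded function of the state and the accumulated weight that does not decrease in
expectation is a lower bound on the probability of the energy objective. -/
theorem le_pathMeasure_of_subharmonic (𝔖 : M.Scheduler) (V : S → ℤ → ℝ≥0∞)
    (hV : ∀ s w, w < 0 → V s w = 0) (hV1 : ∀ s w, V s w ≤ 1)
    (hstep : ∀ (n : ℕ) (h : History S Act n) (hne : Nonempty (M.EnabledAct h.last)),
      M.historySafe h → ∀ α ∈ (𝔖 n h hne).support,
        V h.last (M.historyWeight h) ≤ M.expectedValue V h.last (M.historyWeight h) α.1) :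
    V M.init 0 ≤ M.pathMeasure 𝔖 M.energyObjective := by
  refine M.le_pathMeasure_energyObjective 𝔖 _ fun n => ?_
  rw [← lintegral_safeValue_one]
  refine (M.le_lintegral_safeValue 𝔖 V hV hstep n).trans (lintegral_mono fun h => ?_)
  unfold safeValue
  split_ifs
  · exact hV1 _ _
  · exact le_rfl

/-- A function `V` of the state and the accumulated weight that does not increase in expectation
is an upper bound on the probability of the energy objective if it is at least `1` up to an error
that vanishes geometrically in expectation. -/
theorem pathMeasure_le_of_superharmonic (𝔖 : M.Scheduler) (V R : S → ℤ → ℝ≥0∞) (ρ : ℝ≥0∞)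
    (hρ : ρ < 1) (hV : ∀ s w, w < 0 → V s w = 0) (hR : ∀ s w, w < 0 → R s w = 0)
    (hVR : ∀ s w, 0 ≤ w → 1 ≤ V s w + R s w) (hR0 : R M.init 0 ≠ ∞)
    (hRtrap : ∀ s w, ¬ Nonempty (M.EnabledAct s) → R s w = 0)
    (hstep : ∀ (n : ℕ) (h : History S Act n) (hne : Nonempty (M.EnabledAct h.last)),
      M.historySafe h → ∀ α ∈ (𝔖 n h hne).support,
        M.expectedValue V h.last (M.historyWeight h) α.1 ≤ V h.last (M.historyWeight h))
    (hRstep : ∀ (n : ℕ) (h : History S Act n) (hne : Nonempty (M.EnabledAct h.last)),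
      M.historySafe h → ∀ α ∈ (𝔖 n h hne).support,
        M.expectedValue R h.last (M.historyWeight h) α.1 ≤ ρ * R h.last (M.historyWeight h)) :
    M.pathMeasure 𝔖 M.energyObjective ≤ V M.init 0 := by
  -- On safe histories 1 is at most `V + R`. The expectation of `V` does not grow, and that of `R`
  -- decays like `ρ ^ n`.
  have key : ∀ n, M.pathMeasure 𝔖 M.energyObjective ≤ V M.init 0 + ρ ^ n * R M.init 0 := by
    intro n
    refine (M.pathMeasure_energyObjective_le_prefix 𝔖 n).trans ?_
    rw [← lintegral_safeValue_one]
    calc _ ≤ ∫⁻ h, (M.safeValue V h + M.safeValue R h) ∂(M.historyMeasure 𝔖 n) := by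
          refine lintegral_mono fun h => ?_
          by_cases hs : M.historySafe h
          · simp only [M.safeValue_of_safe _ hs]
            exact hVR _ _ hs.weight_nonneg
          · simp [M.safeValue_of_not_safe _ hs]
      _ = ∫⁻ h, M.safeValue V h ∂(M.historyMeasure 𝔖 n) +
            ∫⁻ h, M.safeValue R h ∂(M.historyMeasure 𝔖 n) :=
          lintegral_add_left (measurable_of_countable _) _
      _ ≤ _ := by
          refine add_le_add ?_ (M.lintegral_safeValue_le 𝔖 R ρ hR (fun s w hs => ?_) hRstep n)
          -- A superharmonic function is the case of contraction factor 1, where the condition on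
          -- traps is trivial.
          · simpa using M.lintegral_safeValue_le 𝔖 V 1 hV (fun s w _ => by simp)
              (by simpa using hstep) n
          · simp [hRtrap s w hs]
  have lim : Filter.Tendsto (fun n => V M.init 0 + ρ ^ n * R M.init 0) Filter.atTop
      (nhds (V M.init 0 + 0 * R M.init 0)) :=
    (ENNReal.Tendsto.mul_const (ENNReal.tendsto_pow_atTop_nhds_zero_of_lt_one hρ)
      (Or.inr hR0)).const_add _
  simpa using ge_of_tendsto' lim key

end WeightedMDP

/-! ### The Markov decision process of a linear recurrence -/

/-- A linear recurrence of order `k` with the coefficients `coeffNum j / coeffDen j` and the initial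
values `initNum j / initDen j`, and a bound `scale` on the numerators. -/
structure ScaledLRS where
  order : ℕ
  scale : ℤ
  coeffNum : ℕ → ℤ
  coeffDen : ℕ → ℤ
  initNum : ℕ → ℤ
  initDen : ℕ → ℤ

namespace ScaledLRS

/-- The strict bounds make all scaled entries smaller than 1 in modulus, and `one_lt_scale` does so
for the entries 1 of the companion matrix. Hence the probabilities in `entry_pos` are positive. -/
structure Valid (D : ScaledLRS) : Prop where
  order_pos : 0 < D.order
  coeffDen_pos : ∀ j < D.order, 0 < D.coeffDen j
  initDen_pos : ∀ j < D.order, 0 < D.initDen j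
  abs_coeffNum_lt : ∀ j < D.order, |D.coeffNum j| < D.scale
  abs_initNum_lt : ∀ j < D.order, |D.initNum j| < D.scale
  one_lt_scale : 1 < D.scale

variable (D : ScaledLRS)

/-- Numerators of the companion matrix. -/
def companionNum (i j : ℕ) : ℤ :=
  if i + 1 < D.order then (if j = i + 1 then 1 else 0) else D.coeffNum j

/-- Denominators of the companion matrix. -/
def companionDen (i j : ℕ) : ℤ :=
  if i + 1 < D.order then 1 else D.coeffDen j

/-- The component of the vector sequence that a state stands for. -/
def component (s : ℕ) : ℕ := if s < 3 + D.order then s - 3 else s - 3 - D.order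

/-- The sign with which a state stands for its component. -/
def sign (s : ℕ) : ℤ := if s < 3 + D.order then 1 else -1

/-- Numerators of the probabilities to move from a component state. -/
def rowNum (s t : ℕ) : ℤ :=
  if t = 0 then 0
  else if t < 3 then
    -- The factor `3 - 2 * t` is 1 for the trap and -1 for the penultimate state.
    D.scale * D.initDen (D.component s) + D.sign s * (3 - 2 * t) * D.initNum (D.component s)
  else
    D.scale * D.companionDen (D.component s) (D.component t) +
      D.sign s * D.sign t * D.companionNum (D.component s) (D.component t)

/-- Denominators of the probabilities to move from a component state. -/
def rowDen (s t : ℕ) : ℤ :=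
  if t = 0 then 1
  else if t < 3 then 4 * D.scale * D.initDen (D.component s)
  else 4 * D.order * D.scale * D.companionDen (D.component s) (D.component t)

/-- Numerators of the transition probabilities. The state `0` is a counter, the state `1` is
a trap, and the state `2` only leads to the trap. -/
def entryNum (z s a t : ℕ) : ℤ :=
  if s = 0 then
    if a = 0 then (if t = 0 then 1 else if t = 3 then 1 else if t = 3 + D.order then 1 else 0)
    -- The parameter `z` selects the copy of component 0 that the second action leads to: positive
    -- for 0, negative for 1.
    else (if t = 0 then 1 else if t = 3 + z * D.order then 1 else 0)
  else if a = 0 then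
    if s = 1 then 0 else if s = 2 then (if t = 1 then 1 else 0) else D.rowNum s t
  else 0

/-- Denominators of the transition probabilities. -/
def entryDen (s a t : ℕ) : ℤ :=
  if s = 0 then (if t = 0 then 2 else if a = 0 then 4 else 2)
  else if a = 0 then (if s < 3 then 1 else D.rowDen s t)
  else 1

/-- Transition probabilities. -/
def entry (z s a t : ℕ) : ℚ := (D.entryNum z s a t : ℚ) / D.entryDen s a t

/-- The companion matrix, scaled to entries of modulus less than `1`. -/
def companion (i j : ℕ) : ℚ := (D.companionNum i j : ℚ) / (D.companionDen i j * D.scale)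

/-- The initial values, scaled to modulus less than `1`. -/
def initial (i : ℕ) : ℚ := (D.initNum i : ℚ) / (D.initDen i * D.scale)

/-- The two copies of each component are paired, since only the sum and the difference of their
values matter. -/
theorem sum_range_states {R : Type*} [AddCommMonoid R] (F : ℕ → R) (k : ℕ) :
    ∑ t ∈ Finset.range (3 + k + k), F t =
      F 0 + F 1 + F 2 + ∑ j ∈ Finset.range k, (F (3 + j) + F (3 + k + j)) := by
  rw [Finset.sum_range_add, Finset.sum_range_add, Finset.sum_add_distrib]
  simp [Finset.sum_range_succ, add_assoc]

variable {D}

theorem component_left {i : ℕ} (hi : i < D.order) : D.component (3 + i) = i := by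
  simp [component, hi]

theorem component_right (i : ℕ) : D.component (3 + D.order + i) = i := by
  simp [component]; omega

theorem sign_left {i : ℕ} (hi : i < D.order) : D.sign (3 + i) = 1 := by
  simp [sign, hi]

theorem sign_right (i : ℕ) : D.sign (3 + D.order + i) = -1 := by
  simp [sign]

namespace Valid

variable (hD : D.Valid)

theorem component_lt {s : ℕ} (h3 : 3 ≤ s) (hs : s < 3 + D.order + D.order) :
    D.component s < D.order := by
  unfold component
  split_ifs <;> omega

theorem sign_eq (s : ℕ) : D.sign s = 1 ∨ D.sign s = -1 := by
  unfold sign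
  split_ifs <;> simp

include hD

theorem companionDen_pos (i : ℕ) {j : ℕ} (hj : j < D.order) : 0 < D.companionDen i j := by
  unfold companionDen
  split_ifs
  · norm_num
  · exact hD.coeffDen_pos j hj

theorem abs_companionNum_lt (i : ℕ) {j : ℕ} (hj : j < D.order) :
    |D.companionNum i j| < D.scale := by
  have := hD.one_lt_scale
  unfold companionNum
  split_ifs
  · simpa
  · simp; omega
  · exact hD.abs_coeffNum_lt j hj

theorem abs_div_lt_one {n d : ℤ} (hd : 0 < d) (hn : |n| < D.scale) :
    |(n : ℚ) / (d * D.scale)| < 1 := by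
  have hZ : (0 : ℚ) < D.scale := by exact_mod_cast one_pos.trans hD.one_lt_scale
  have hd' : (1 : ℚ) ≤ d := by exact_mod_cast hd
  have hn' : |(n : ℚ)| < D.scale := by exact_mod_cast hn
  rw [abs_div, div_lt_one (by positivity), abs_of_pos (by positivity : (0 : ℚ) < d * D.scale)]
  nlinarith

theorem abs_companion_lt (i : ℕ) {j : ℕ} (hj : j < D.order) : |D.companion i j| < 1 :=
  hD.abs_div_lt_one (hD.companionDen_pos i hj) (hD.abs_companionNum_lt i hj)

theorem abs_initial_lt {j : ℕ} (hj : j < D.order) : |D.initial j| < 1 :=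
  hD.abs_div_lt_one (hD.initDen_pos j hj) (hD.abs_initNum_lt j hj)

theorem entry_trap (z : ℕ) {s : ℕ} (h3 : 3 ≤ s) (hs : s < 3 + D.order + D.order) :
    D.entry z s 0 1 = (1 + D.sign s * D.initial (D.component s)) / 4 := by
  have hZ : (D.scale : ℚ) ≠ 0 := by exact_mod_cast (one_pos.trans hD.one_lt_scale).ne'
  have hd : (D.initDen (D.component s) : ℚ) ≠ 0 := by
    exact_mod_cast (hD.initDen_pos _ (component_lt h3 hs)).ne'
  have h0 : s ≠ 0 := by omega
  have h1 : s ≠ 1 := by omega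
  have h2 : s ≠ 2 := by omega
  have h3' : ¬ s < 3 := by omega
  simp only [entry, entryNum, entryDen, rowNum, rowDen, initial, h0, h1, h2, h3', if_true, if_false,
    one_ne_zero, show (1 : ℕ) < 3 by norm_num]
  push_cast
  field_simp

theorem entry_penultimate (z : ℕ) {s : ℕ} (h3 : 3 ≤ s) (hs : s < 3 + D.order + D.order) :
    D.entry z s 0 2 = (1 - D.sign s * D.initial (D.component s)) / 4 := by
  have hZ : (D.scale : ℚ) ≠ 0 := by exact_mod_cast (one_pos.trans hD.one_lt_scale).ne'
  have hd : (D.initDen (D.component s) : ℚ) ≠ 0 := by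
    exact_mod_cast (hD.initDen_pos _ (component_lt h3 hs)).ne'
  have h0 : s ≠ 0 := by omega
  have h1 : s ≠ 1 := by omega
  have h2 : s ≠ 2 := by omega
  have h3' : ¬ s < 3 := by omega
  simp only [entry, entryNum, entryDen, rowNum, rowDen, initial, h0, h1, h2, h3', if_true, if_false,
    two_ne_zero, show (2 : ℕ) < 3 by norm_num]
  push_cast
  field_simp
  ring

theorem entry_component (z : ℕ) {s t : ℕ} (h3 : 3 ≤ s) (ht3 : 3 ≤ t)
    (ht : t < 3 + D.order + D.order) :
    D.entry z s 0 t =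
      (1 + D.sign s * D.sign t * D.companion (D.component s) (D.component t)) / (4 * D.order) := by
  have hZ : (D.scale : ℚ) ≠ 0 := by exact_mod_cast (one_pos.trans hD.one_lt_scale).ne'
  have hk : (D.order : ℚ) ≠ 0 := by exact_mod_cast hD.order_pos.ne'
  have hd : (D.companionDen (D.component s) (D.component t) : ℚ) ≠ 0 := by
    exact_mod_cast (hD.companionDen_pos _ (component_lt ht3 ht)).ne'
  have h0 : s ≠ 0 := by omega
  have h1 : s ≠ 1 := by omega
  have h2 : s ≠ 2 := by omega
  have h3' : ¬ s < 3 := by omega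
  have h0t : t ≠ 0 := by omega
  have h3t : ¬ t < 3 := by omega
  simp only [entry, entryNum, entryDen, rowNum, rowDen, companion, h0, h1, h2, h3', h0t, h3t,
    if_true, if_false]
  push_cast
  field_simp

/-- Expectations over the successors of a component state. -/
theorem sum_entry_mul (z : ℕ) {s : ℕ} (h3 : 3 ≤ s) (hs : s < 3 + D.order + D.order) (G : ℕ → ℝ) :
    ∑ t ∈ Finset.range (3 + D.order + D.order), (D.entry z s 0 t : ℝ) * G t =
      (1 + D.sign s * D.initial (D.component s)) / 4 * G 1 +
      (1 - D.sign s * D.initial (D.component s)) / 4 * G 2 +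
      ∑ j ∈ Finset.range D.order, ((G (3 + j) + G (3 + D.order + j)) / (4 * D.order) +
        D.sign s * (D.companion (D.component s) j / (4 * D.order) *
          (G (3 + j) - G (3 + D.order + j)))) := by
  rw [sum_range_states, hD.entry_trap z h3 hs, hD.entry_penultimate z h3 hs]
  have h00 : D.entry z s 0 0 = 0 := by
    have h0 : s ≠ 0 := by omega
    have h1 : s ≠ 1 := by omega
    have h2 : s ≠ 2 := by omega
    simp [entry, entryNum, rowNum, h0, h1, h2]
  rw [h00]
  push_cast
  rw [zero_mul, zero_add]
  congr 1
  refine Finset.sum_congr rfl fun j hj => ?_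
  have hj := Finset.mem_range.1 hj
  rw [hD.entry_component z h3 (by omega) (by omega), hD.entry_component z h3 (by omega) (by omega),
    component_left hj, component_right, sign_left hj, sign_right]
  push_cast
  ring

theorem abs_sign_mul_lt {x : ℚ} (s : ℕ) (hx : |x| < 1) : |(D.sign s : ℚ) * x| < 1 := by
  rcases sign_eq (D := D) s with h | h <;> simpa [h] using hx

/-- This also gives reachability: a component state reaches every state but the counter in one step.
-/
theorem entry_pos (z : ℕ) {s t : ℕ} (h3 : 3 ≤ s) (hs : s < 3 + D.order + D.order)
    (ht0 : t ≠ 0) (ht : t < 3 + D.order + D.order) : 0 < D.entry z s 0 t := by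
  have hi := abs_lt.1 (hD.abs_sign_mul_lt s (hD.abs_initial_lt (component_lt h3 hs)))
  have hk : (0 : ℚ) < D.order := by exact_mod_cast hD.order_pos
  rcases (by omega : t = 1 ∨ t = 2 ∨ 3 ≤ t) with rfl | rfl | ht3
  · rw [hD.entry_trap z h3 hs]
    linarith
  · rw [hD.entry_penultimate z h3 hs]
    linarith
  · rw [hD.entry_component z h3 ht3 ht, mul_assoc]
    have := abs_lt.1 (hD.abs_sign_mul_lt s
      (hD.abs_sign_mul_lt t (hD.abs_companion_lt (D.component s) (component_lt ht3 ht))))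
    exact div_pos (by linarith) (by linarith)

theorem entry_nonneg (z s a : ℕ) {t : ℕ} (hs : s < 3 + D.order + D.order)
    (ht : t < 3 + D.order + D.order) : 0 ≤ D.entry z s a t := by
  by_cases h : 3 ≤ s ∧ a = 0 ∧ t ≠ 0
  · rw [h.2.1]
    exact (hD.entry_pos z h.1 hs h.2.2 ht).le
  · unfold entry
    apply div_nonneg
    · unfold entryNum
      split_ifs <;> try norm_num
      have : t = 0 := by
        by_contra h'
        exact h ⟨by omega, ‹_›, h'⟩
      simp [rowNum, this]
    · unfold entryDen rowDen
      split_ifs <;> try norm_num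
      all_goals exact absurd ⟨by omega, ‹_›, ‹_›⟩ h

end Valid

theorem entry_zero_zero (z t : ℕ) : D.entry z 0 0 t =
    if t = 0 then 1 / 2 else if t = 3 then 1 / 4 else if t = 3 + D.order then 1 / 4 else 0 := by
  unfold entry entryNum entryDen
  split_ifs <;> simp_all

theorem entry_zero_one (z t : ℕ) : D.entry z 0 1 t =
    if t = 0 then 1 / 2 else if t = 3 + z * D.order then 1 / 2 else 0 := by
  unfold entry entryNum entryDen
  split_ifs <;> simp_all

theorem entry_one (z a t : ℕ) : D.entry z 1 a t = 0 := by
  unfold entry entryNum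
  split_ifs <;> simp_all

theorem entry_two_zero (z t : ℕ) : D.entry z 2 0 t = if t = 1 then 1 else 0 := by
  unfold entry entryNum entryDen
  split_ifs <;> simp_all

theorem entry_action_one (z t : ℕ) {s : ℕ} (hs : s ≠ 0) : D.entry z s 1 t = 0 := by
  unfold entry entryNum
  split_ifs <;> simp_all

theorem sum_entry_zero_zero (z : ℕ) (k0 : 0 < D.order) (G : ℕ → ℝ) :
    ∑ t ∈ Finset.range (3 + D.order + D.order), (D.entry z 0 0 t : ℝ) * G t =
      1 / 2 * G 0 + 1 / 4 * (G 3 + G (3 + D.order)) := by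
  have h : ∀ t, (D.entry z 0 0 t : ℝ) * G t = (if t = 0 then 1 / 2 * G 0 else 0) +
      ((if t = 3 then 1 / 4 * G 3 else 0) +
        (if t = 3 + D.order then 1 / 4 * G (3 + D.order) else 0)) := by
    intro t
    rw [entry_zero_zero z t]
    split_ifs <;> first | omega | simp_all
  rw [Finset.sum_congr rfl fun t _ => h t]
  simp only [Finset.sum_add_distrib, Finset.sum_ite_eq', Finset.mem_range]
  rw [if_pos (by omega), if_pos (by omega), if_pos (by omega)]
  ring

theorem sum_entry_zero_one {z : ℕ} (hz : z < 2) (k0 : 0 < D.order) (G : ℕ → ℝ) :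
    ∑ t ∈ Finset.range (3 + D.order + D.order), (D.entry z 0 1 t : ℝ) * G t =
      1 / 2 * G 0 + 1 / 2 * G (3 + z * D.order) := by
  have h : ∀ t, (D.entry z 0 1 t : ℝ) * G t = (if t = 0 then 1 / 2 * G 0 else 0) +
      (if t = 3 + z * D.order then 1 / 2 * G (3 + z * D.order) else 0) := by
    intro t
    rw [entry_zero_one z t]
    split_ifs <;> first | omega | simp_all
  rw [Finset.sum_congr rfl fun t _ => h t]
  simp only [Finset.sum_add_distrib, Finset.sum_ite_eq', Finset.mem_range]
  rw [if_pos (by omega), if_pos]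
  have : z * D.order ≤ 1 * D.order := Nat.mul_le_mul_right _ (by omega)
  omega

theorem sum_entry_two_zero (z : ℕ) (G : ℕ → ℝ) :
    ∑ t ∈ Finset.range (3 + D.order + D.order), (D.entry z 2 0 t : ℝ) * G t = G 1 := by
  have h : ∀ t, (D.entry z 2 0 t : ℝ) * G t = if t = 1 then G 1 else 0 := by
    intro t
    rw [entry_two_zero z t]
    split_ifs <;> simp_all
  rw [Finset.sum_congr rfl fun t _ => h t, Finset.sum_ite_eq', if_pos]
  simp; omega

theorem Valid.sum_entry (hD : D.Valid) {z : ℕ} (hz : z < 2) {s a : ℕ} (ha : a < 2)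
    (hs : s < 3 + D.order + D.order) :
    ∑ t ∈ Finset.range (3 + D.order + D.order), D.entry z s a t =
      if (a = 0 ∧ s ≠ 1) ∨ s = 0 then 1 else 0 := by
  -- Row sums are expectations of the constant function 1, so the formulas for expectations yield
  -- them.
  have key : ∑ t ∈ Finset.range (3 + D.order + D.order), (D.entry z s a t : ℝ) * 1 =
      if (a = 0 ∧ s ≠ 1) ∨ s = 0 then 1 else 0 := by
    rcases (by omega : s = 0 ∨ s = 1 ∨ s = 2 ∨ 3 ≤ s) with rfl | rfl | rfl | h3 <;>
      rcases (by omega : a = 0 ∨ a = 1) with rfl | rfl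
    · rw [sum_entry_zero_zero z hD.order_pos fun _ => 1]
      norm_num
    · rw [sum_entry_zero_one hz hD.order_pos fun _ => 1]
      norm_num
    · simp [entry_one]
    · simp [entry_one]
    · rw [sum_entry_two_zero z fun _ => 1]
      simp
    · simp [entry_action_one]
    · rw [hD.sum_entry_mul z h3 hs fun _ => 1]
      have hk : (D.order : ℝ) ≠ 0 := by exact_mod_cast hD.order_pos.ne'
      have h1 : s ≠ 1 := by omega
      simp [h1]
      field_simp
      ring
    · have h0 : s ≠ 0 := by omega
      simp [entry_action_one, h0]
  simp only [mul_one] at key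
  rw [← @Rat.cast_inj ℝ]
  push_cast
  rw [key]
  split_ifs <;> simp

/-- The Markov decision process associated with a linear recurrence. -/
def mdp (hD : D.Valid) {z : ℕ} (hz : z < 2) :
    WeightedMDP (Fin (3 + D.order + D.order)) (Fin 2) where
  prob s a t := D.entry z s a t
  prob_nonneg s a t := hD.entry_nonneg z s a s.2 t.2
  prob_sum s a := by
    rw [Fin.sum_univ_eq_sum_range fun t => D.entry z s a t, hD.sum_entry hz a.2 s.2]
    split_ifs <;> simp
  init := ⟨0, by omega⟩
  reachable s := by
    have hk := hD.order_pos
    have h3 : Relation.ReflTransGen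
        (fun s t : Fin (3 + D.order + D.order) => ∃ a : Fin 2, 0 < D.entry z s a t)
        ⟨0, by omega⟩ ⟨3, by omega⟩ :=
      .single ⟨0, by rw [Fin.val_zero, entry_zero_zero z _]; norm_num⟩
    by_cases hs : s.1 = 0
    · have : s = ⟨0, by omega⟩ := Fin.ext hs
      rw [this]
    · exact h3.tail ⟨0, hD.entry_pos z le_rfl (by simp; omega) hs s.2⟩
  wgt s _ := if s.1 = 0 then 1 else -1

end ScaledLRS

/-! ### Values of the states outside the counter -/

namespace ScaledLRS

variable {D : ScaledLRS}

/-- A function of the state and a natural number as a function of the state and the accumulated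
weight that vanishes for negative weights. -/
noncomputable def ofWeight {N : ℕ} (F : ℕ → ℕ → ℝ) (s : Fin N) (w : ℤ) : ℝ≥0∞ :=
  if w < 0 then 0 else ENNReal.ofReal (F s w.toNat)

theorem ofWeight_natCast {N : ℕ} (F : ℕ → ℕ → ℝ) (s : Fin N) (n : ℕ) :
    ofWeight F s (n : ℤ) = ENNReal.ofReal (F s n) := by
  simp [ofWeight]

theorem ofWeight_neg {N : ℕ} (F : ℕ → ℕ → ℝ) (s : Fin N) (w : ℤ) (hw : w < 0) :
    ofWeight F s w = 0 := if_pos hw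

theorem mdp_wgt (hD : D.Valid) {z : ℕ} (hz : z < 2) (s : Fin (3 + D.order + D.order))
    (a : Fin 2) : (mdp hD hz).wgt s a = if s.1 = 0 then 1 else -1 := rfl

section Expectation

variable (hD : D.Valid) {z : ℕ} (hz : z < 2) {F : ℕ → ℕ → ℝ}
  (hF : ∀ s n, s < 3 + D.order + D.order → 0 ≤ F s n)
include hD hF

theorem sum_ofReal_entry_mul {s : ℕ} (hs : s < 3 + D.order + D.order) (a n : ℕ) :
    ∑ t : Fin (3 + D.order + D.order), ENNReal.ofReal ((D.entry z s a t : ℚ) : ℝ) *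
        ENNReal.ofReal (F t n) =
      ENNReal.ofReal (∑ t ∈ Finset.range (3 + D.order + D.order),
        (D.entry z s a t : ℝ) * F t n) := by
  have h0 : ∀ t : Fin (3 + D.order + D.order), 0 ≤ ((D.entry z s a t : ℚ) : ℝ) := fun t => by
    exact_mod_cast hD.entry_nonneg z s a hs t.2
  rw [← Fin.sum_univ_eq_sum_range fun t => (D.entry z s a t : ℝ) * F t n,
    ENNReal.ofReal_sum_of_nonneg fun t _ => mul_nonneg (h0 t) (hF t n t.2)]
  exact Finset.sum_congr rfl fun t _ => (ENNReal.ofReal_mul (h0 t)).symm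

theorem expectedValue_counter (s : Fin (3 + D.order + D.order)) (hs : s.1 = 0) (a : Fin 2)
    (n : ℕ) : (mdp hD hz).expectedValue (ofWeight F) s n a =
      ENNReal.ofReal (∑ t ∈ Finset.range (3 + D.order + D.order),
        (D.entry z 0 a t : ℝ) * F t (n + 1)) := by
  rw [← sum_ofReal_entry_mul hD hF (by omega)]
  refine Finset.sum_congr rfl fun t _ => ?_
  have : ((n : ℤ) + (mdp hD hz).wgt s a) = ((n + 1 : ℕ) : ℤ) := by
    simp [mdp_wgt, hs]
  rw [this, ofWeight_natCast]
  simp [mdp, hs]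

theorem expectedValue_succ (s : Fin (3 + D.order + D.order)) (hs : s.1 ≠ 0) (a : Fin 2)
    (n : ℕ) : (mdp hD hz).expectedValue (ofWeight F) s ((n + 1 : ℕ) : ℤ) a =
      ENNReal.ofReal (∑ t ∈ Finset.range (3 + D.order + D.order),
        (D.entry z s a t : ℝ) * F t n) := by
  rw [← sum_ofReal_entry_mul hD hF s.2]
  refine Finset.sum_congr rfl fun t _ => ?_
  have : (((n + 1 : ℕ) : ℤ) + (mdp hD hz).wgt s a) = n := by
    simp [mdp_wgt, hs]
  rw [this, ofWeight_natCast]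
  simp [mdp]

omit hF in
theorem expectedValue_zero (s : Fin (3 + D.order + D.order)) (hs : s.1 ≠ 0) (a : Fin 2) :
    (mdp hD hz).expectedValue (ofWeight F) s ((0 : ℕ) : ℤ) a = 0 := by
  refine Finset.sum_eq_zero fun t _ => ?_
  rw [ofWeight_neg _ _ _ (by simp [mdp_wgt, hs]), mul_zero]

omit hF in
theorem enabled_iff (s : Fin (3 + D.order + D.order)) (a : Fin 2) :
    ∑ t, (mdp hD hz).prob s a t = 1 ↔ (a = 0 ∧ s.1 ≠ 1) ∨ s.1 = 0 := by
  have := hD.sum_entry hz a.2 s.2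
  rw [← Fin.sum_univ_eq_sum_range fun t => D.entry z s a t] at this
  change ∑ t : Fin (3 + D.order + D.order), D.entry z s a t = 1 ↔ _
  rw [this]
  simp only [Fin.val_eq_zero_iff]
  split_ifs with h <;> simp [h]

end Expectation

/-- `D` describes the sequence `u`. -/
structure Describes (D : ScaledLRS) (u : ℕ → ℚ) : Prop where
  init : ∀ j < D.order, u j = (D.initNum j : ℚ) / D.initDen j
  recurrence : ∀ n, u (n + D.order) =
    ∑ j ∈ Finset.range D.order, (D.coeffNum j : ℚ) / D.coeffDen j * u (n + j)

/-- The vector sequence of a linear recurrence, scaled down. -/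
noncomputable def vec (D : ScaledLRS) (u : ℕ → ℚ) (i m : ℕ) : ℝ :=
  -- The first factor makes the vector at time 0 half of the scaled initial values. The power
  -- accounts for multiplication by the scaled companion matrix divided by `2 * D.order` in each
  -- step.
  u (m + i) / (2 * D.scale) / (2 * D.order * D.scale) ^ m

section Values

variable (hD : D.Valid) {u : ℕ → ℚ} (hu : D.Describes u)
include hD hu

theorem vec_zero {i : ℕ} (hi : i < D.order) : D.vec u i 0 = D.initial i / 2 := by
  have hZ : (D.scale : ℝ) ≠ 0 := by exact_mod_cast (one_pos.trans hD.one_lt_scale).ne'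
  have hd : (D.initDen i : ℝ) ≠ 0 := by exact_mod_cast (hD.initDen_pos i hi).ne'
  simp only [vec, initial, zero_add, hu.init i hi]
  push_cast
  field_simp

/-- The rows of the companion matrix other than the last shift the window of `D.order` consecutive
members, and the last row is the recurrence. -/
theorem vec_succ {i : ℕ} (hi : i < D.order) (m : ℕ) : D.vec u i (m + 1) =
    ∑ j ∈ Finset.range D.order, D.companion i j / (2 * D.order) * D.vec u j m := by
  have hZ : (D.scale : ℝ) ≠ 0 := by exact_mod_cast (one_pos.trans hD.one_lt_scale).ne'
  have hk : (D.order : ℝ) ≠ 0 := by exact_mod_cast hD.order_pos.ne'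
  have key : u (m + 1 + i) = ∑ j ∈ Finset.range D.order,
      (D.companionNum i j : ℚ) / D.companionDen i j * u (m + j) := by
    by_cases h : i + 1 < D.order
    · simp only [companionNum, companionDen, h, if_true]
      rw [Finset.sum_eq_single (i + 1)]
      · simp only [if_true]
        rw [show m + 1 + i = m + (i + 1) by ring]
        simp
      · intro j _ hj
        simp [hj]
      · intro h'
        exact absurd (Finset.mem_range.2 h) h'
    · simp only [companionNum, companionDen, h, if_false]
      rw [← hu.recurrence]
      congr 1
      omega
  simp only [vec, companion, key]
  push_cast
  rw [Finset.sum_div, Finset.sum_div]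
  refine Finset.sum_congr rfl fun j hj => ?_
  have hd : (D.companionDen i j : ℝ) ≠ 0 := by
    exact_mod_cast (hD.companionDen_pos i (Finset.mem_range.1 hj)).ne'
  rw [pow_succ]
  field_simp

/-- A row has `D.order` entries, each less than `1 / (2 * D.order)` in modulus after scaling, so the
maximum norm is at least halved in each step. -/
theorem abs_vec_le {i : ℕ} (hi : i < D.order) (m : ℕ) : |D.vec u i m| ≤ 1 / 2 ^ (m + 1) := by
  have hk : (0 : ℝ) < D.order := by exact_mod_cast hD.order_pos
  induction m generalizing i with
  | zero =>
    have : |(D.initial i : ℝ)| < 1 := by exact_mod_cast hD.abs_initial_lt hi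
    rw [vec_zero hD hu hi, abs_div]
    norm_num
    linarith
  | succ m ih =>
    rw [vec_succ hD hu hi]
    calc _ ≤ ∑ j ∈ Finset.range D.order, |(D.companion i j : ℝ) / (2 * D.order) * D.vec u j m| :=
          Finset.abs_sum_le_sum_abs _ _
      _ ≤ ∑ j ∈ Finset.range D.order, (1 : ℝ) / (2 * D.order) * (1 / 2 ^ (m + 1)) := by
          refine Finset.sum_le_sum fun j hj => ?_
          have hj := Finset.mem_range.1 hj
          have : |(D.companion i j : ℝ)| < 1 := by exact_mod_cast hD.abs_companion_lt i hj
          rw [abs_mul, abs_div, abs_of_pos (by positivity : (0 : ℝ) < 2 * D.order)]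
          gcongr
          exact ih hj
      _ = _ := by
          rw [Finset.sum_const, Finset.card_range, nsmul_eq_mul]
          field_simp
          ring

/-- The probability of the energy objective if the state is not the counter. For the counter, it is
given by `C`. -/
noncomputable def value (D : ScaledLRS) (u : ℕ → ℚ) (C : ℕ → ℝ) (s n : ℕ) : ℝ :=
  if s = 0 then C n
  else if s = 1 then 1
  else if n = 0 then 0
  else if s = 2 then 1
  -- One unit of weight is needed for the final step into the trap, hence the index `n - 1`: at
  -- weight 1 the formula equals the probability of entering the trap at once.
  else (2 - 3 / 2 ^ n + D.sign s * D.vec u (D.component s) (n - 1)) / 2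

omit hD hu in
theorem value_of_three_le {C : ℕ → ℝ} {s : ℕ} (h3 : 3 ≤ s) (m : ℕ) : D.value u C s (m + 1) =
    (2 - 3 / 2 ^ (m + 1) + D.sign s * D.vec u (D.component s) m) / 2 := by
  simp [value, show s ≠ 0 by omega, show s ≠ 1 by omega, show s ≠ 2 by omega]

/-- At weight `n ≥ 1` the contribution of the sequence is at most `1 / 2 ^ n` in modulus, so twice
the value lies between `2 - 4 / 2 ^ n` and 2. -/
theorem value_mem {C : ℕ → ℝ} (hC : ∀ n, 0 ≤ C n ∧ C n ≤ 1) (s n : ℕ)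
    (hs : s < 3 + D.order + D.order) : 0 ≤ D.value u C s n ∧ D.value u C s n ≤ 1 := by
  rcases (by omega : s = 0 ∨ s = 1 ∨ s = 2 ∨ 3 ≤ s) with rfl | rfl | rfl | h3
  · simpa [value] using hC n
  · simp [value]
  · simp only [value, OfNat.ofNat_ne_zero, OfNat.ofNat_ne_one, if_false]
    split_ifs <;> norm_num
  · cases n with
    | zero => simp [value, show s ≠ 0 by omega, show s ≠ 1 by omega]
    | succ m =>
      rw [value_of_three_le h3]
      have hb := abs_vec_le hD hu (Valid.component_lt h3 hs) m
      have h1 : (1 : ℝ) / 2 ^ (m + 1) ≤ 1 / 2 := by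
        rw [pow_succ]
        gcongr
        have : (1 : ℝ) ≤ 2 ^ m := one_le_pow₀ (by norm_num)
        linarith
      have h3' : (3 : ℝ) / 2 ^ (m + 1) = 3 * (1 / 2 ^ (m + 1)) := by ring
      rw [h3']
      have := abs_le.1 hb
      rcases Valid.sign_eq (D := D) s with h | h <;> rw [h] <;> push_cast <;>
        constructor <;> linarith

/-- The unsigned part of the transition probabilities sees the sum over the two copies, in which the
sequence cancels. The signed part sees the difference, which is the vector sequence, and multiplies
it by the companion matrix. -/
theorem sum_entry_mul_value (z : ℕ) (C : ℕ → ℝ) {s : ℕ} (h3 : 3 ≤ s)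
    (hs : s < 3 + D.order + D.order) (n : ℕ) :
    ∑ t ∈ Finset.range (3 + D.order + D.order), (D.entry z s 0 t : ℝ) * D.value u C t n =
      D.value u C s (n + 1) := by
  have hk : (D.order : ℝ) ≠ 0 := by exact_mod_cast hD.order_pos.ne'
  rw [hD.sum_entry_mul z h3 hs fun t => D.value u C t n, value_of_three_le h3]
  -- If no weight is left after the step, only the trap has a positive value among the successors,
  -- so the initial values enter here.
  cases n with
  | zero =>
    rw [vec_zero hD hu (Valid.component_lt h3 hs), Finset.sum_eq_zero]
    · simp [value]
      ring
    · intro j _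
      simp [value, show 3 + j ≠ 1 by omega, show 3 + D.order + j ≠ 1 by omega]
  | succ m =>
    rw [vec_succ hD hu (Valid.component_lt h3 hs), Finset.mul_sum]
    have : ∀ j ∈ Finset.range D.order,
        (D.value u C (3 + j) (m + 1) + D.value u C (3 + D.order + j) (m + 1)) / (4 * D.order) +
          D.sign s * (D.companion (D.component s) j / (4 * D.order) *
            (D.value u C (3 + j) (m + 1) - D.value u C (3 + D.order + j) (m + 1))) =
        (2 - 3 / 2 ^ (m + 1)) / (4 * D.order) +
          (D.sign s * (D.companion (D.component s) j / (2 * D.order) * D.vec u j m)) / 2 := by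
      intro j hj
      have hj := Finset.mem_range.1 hj
      rw [value_of_three_le (by omega), value_of_three_le (by omega), component_left hj,
        component_right, sign_left hj, sign_right]
      push_cast
      field_simp
      ring
    rw [Finset.sum_congr rfl this, Finset.sum_add_distrib, Finset.sum_const, Finset.card_range,
      ← Finset.sum_div, nsmul_eq_mul]
    simp only [value, one_ne_zero, if_true, if_false, OfNat.ofNat_ne_zero, OfNat.ofNat_ne_one,
      Nat.add_eq_zero_iff, and_false]
    have h2 : (2 : ℝ) ^ (m + 1) ≠ 0 := by positivity
    rw [pow_succ 2 (m + 1)]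
    field_simp
    ring

/-- Outside the counter at most one action is enabled, so the value is harmonic there whatever the
scheduler does. -/
theorem expectedValue_value {z : ℕ} (hz : z < 2) {C : ℕ → ℝ} (hC : ∀ n, 0 ≤ C n ∧ C n ≤ 1)
    {s : Fin (3 + D.order + D.order)} (hs : s.1 ≠ 0) (α : (mdp hD hz).EnabledAct s) {w : ℤ}
    (hw : 0 ≤ w) : (mdp hD hz).expectedValue (ofWeight (D.value u C)) s w α.1 =
      ofWeight (D.value u C) s w := by
  have hF : ∀ s n, s < 3 + D.order + D.order → 0 ≤ D.value u C s n :=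
    fun s n h => (value_mem hD hu hC s n h).1
  obtain ⟨α, hα⟩ := α
  obtain ⟨rfl, hs1⟩ | h := (enabled_iff hD hz s α).1 hα
  · lift w to ℕ using hw
    rw [ofWeight_natCast]
    cases w with
    | zero =>
      rw [expectedValue_zero hD hz s hs]
      simp [value, hs, hs1]
    | succ m =>
      rw [expectedValue_succ hD hz hF s hs]
      congr 1
      by_cases h2 : s.1 = 2
      · rw [h2]
        rw [Fin.val_zero, sum_entry_two_zero z fun t => D.value u C t m]
        simp [value]
      · rw [Fin.val_zero, sum_entry_mul_value hD hu z C (by omega) s.2]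
  · exact absurd h hs

end Values

/-! ### The two actions of the counter -/

/-- The probability of the energy objective from the counter if the second action is taken when the
accumulated weight is `n₀`, where `e` is the gain of this action. -/
noncomputable def counterValue (n₀ : ℕ) (e : ℝ) (n : ℕ) : ℝ :=
  -- From weight `n ≤ n₀` the counter is left only after weight `n₀` is reached with probability `2
  -- ^ n / 2 ^ n₀`. Beyond `n₀` the gain can no longer be collected.
  1 - 1 / 2 ^ (n + 1) + if n ≤ n₀ then 2 ^ n / 2 ^ n₀ * e else 0

theorem counterValue_mem {n₀ : ℕ} {e : ℝ} (he : |e| ≤ 1 / 2 ^ (n₀ + 1)) (n : ℕ) :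
    0 ≤ counterValue n₀ e n ∧ counterValue n₀ e n ≤ 1 := by
  have h1 : (1 : ℝ) / 2 ^ (n + 1) ≤ 1 / 2 := by
    rw [pow_succ]
    gcongr
    have : (1 : ℝ) ≤ 2 ^ n := one_le_pow₀ (by norm_num)
    linarith
  have h2 : |if n ≤ n₀ then 2 ^ n / 2 ^ n₀ * e else 0| ≤ 1 / 2 ^ (n + 1) := by
    split_ifs with h
    · rw [abs_mul, abs_of_pos (by positivity)]
      have h3 : (2 : ℝ) ^ n / 2 ^ n₀ ≤ 1 :=
        (div_le_one (by positivity)).2 (pow_le_pow_right₀ (by norm_num) h)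
      calc _ ≤ 1 * |e| := mul_le_mul_of_nonneg_right h3 (abs_nonneg e)
        _ ≤ 1 / 2 ^ (n₀ + 1) := by rwa [one_mul]
        _ ≤ _ := one_div_le_one_div_of_le (by positivity)
            (pow_le_pow_right₀ (by norm_num) (by omega))
    · rw [abs_zero]
      positivity
  have := abs_le.1 h2
  unfold counterValue
  constructor <;> linarith

/-- The term `1 - 1 / 2 ^ (n + 1)` solves the equation for the first action. Since the counter
persists with probability 1/2, a correction that doubles with `n` solves the homogeneous equation.
-/
theorem counterValue_step {n₀ : ℕ} {e : ℝ} {n : ℕ} (hn : n ≠ n₀) :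
    1 / 2 * counterValue n₀ e (n + 1) + 1 / 4 * (2 - 3 / 2 ^ (n + 1)) = counterValue n₀ e n := by
  unfold counterValue
  rcases lt_or_gt_of_ne hn with h | h
  · rw [if_pos (by omega), if_pos h.le, pow_succ, pow_succ]
    field_simp
    ring
  · rw [if_neg (by omega), if_neg (by omega), pow_succ, pow_succ]
    field_simp
    ring

theorem counterValue_step_self (n₀ : ℕ) (e : ℝ) :
    1 / 2 * counterValue n₀ e (n₀ + 1) + 1 / 4 * (2 - 3 / 2 ^ (n₀ + 1)) + e =
      counterValue n₀ e n₀ := by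
  unfold counterValue
  rw [if_neg (by omega), if_pos le_rfl, pow_succ, pow_succ]
  field_simp
  ring

theorem counterValue_zero (n₀ : ℕ) (e : ℝ) : counterValue n₀ e 0 = 1 / 2 + e / 2 ^ n₀ := by
  unfold counterValue
  rw [if_pos (Nat.zero_le _)]
  ring

section Counter

variable (hD : D.Valid) {z : ℕ} (hz : z < 2) {u : ℕ → ℚ} (hu : D.Describes u)
include hD hu

/-- The change of the probability of the energy objective by taking the second action. -/
noncomputable def gain (D : ScaledLRS) (u : ℕ → ℚ) (z n : ℕ) : ℝ :=
  D.sign (3 + z * D.order) * D.vec u 0 n / 4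

omit hD hu in
theorem sign_mul (hz : z < 2) (k0 : 0 < D.order) :
    D.sign (3 + z * D.order) = if z = 0 then 1 else -1 := by
  obtain rfl | rfl : z = 0 ∨ z = 1 := by omega
  · simp [sign, k0]
  · simp [sign]

omit hD hu in
theorem component_mul (hz : z < 2) (k0 : 0 < D.order) :
    D.component (3 + z * D.order) = 0 := by
  obtain rfl | rfl : z = 0 ∨ z = 1 := by omega
  · simp [component, k0]
  · simp [component]

theorem abs_gain_le (n : ℕ) : |D.gain u z n| ≤ 1 / 2 ^ (n + 1) := by
  have h := abs_vec_le hD hu hD.order_pos n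
  have h' : |D.gain u z n| = |D.vec u 0 n| / 4 := by
    unfold gain
    rw [abs_div, abs_mul]
    rcases Valid.sign_eq (D := D) (3 + z * D.order) with h | h <;> rw [h] <;> norm_num
  have := abs_nonneg (D.vec u 0 n)
  rw [h']
  linarith

variable {n₀ : ℕ} {e : ℝ} (he : |e| ≤ 1 / 2 ^ (n₀ + 1))
include he

/-- The two copies of component 0 are equally likely, so the sequence cancels. -/
theorem expectedValue_counter_first {s : Fin (3 + D.order + D.order)} (hs : s.1 = 0) (n : ℕ) :
    (mdp hD hz).expectedValue (ofWeight (D.value u (counterValue n₀ e))) s n 0 =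
      ENNReal.ofReal (1 / 2 * counterValue n₀ e (n + 1) + 1 / 4 * (2 - 3 / 2 ^ (n + 1))) := by
  rw [expectedValue_counter hD hz
    (fun s n h => (value_mem hD hu (counterValue_mem he) s n h).1) s hs, Fin.val_zero,
    sum_entry_zero_zero z hD.order_pos fun t => D.value u _ t (n + 1),
    value_of_three_le le_rfl, value_of_three_le (s := 3 + D.order) (Nat.le_add_right _ _)]
  have h1 := component_mul (D := D) (by norm_num : 0 < 2) hD.order_pos
  have h2 := component_mul (D := D) (by norm_num : 1 < 2) hD.order_pos
  have h3 := sign_mul (D := D) (by norm_num : 0 < 2) hD.order_pos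
  have h4 := sign_mul (D := D) (by norm_num : 1 < 2) hD.order_pos
  simp only [zero_mul, one_mul, add_zero, if_true, one_ne_zero, if_false] at h1 h2 h3 h4
  rw [h1, h2, h3, h4]
  congr 1
  simp only [value, if_true]
  push_cast
  ring

/-- Only one copy is entered, so the member of the sequence at the current weight survives with the
sign of that copy. -/
theorem expectedValue_counter_second {s : Fin (3 + D.order + D.order)} (hs : s.1 = 0) (n : ℕ) :
    (mdp hD hz).expectedValue (ofWeight (D.value u (counterValue n₀ e))) s n 1 =
      ENNReal.ofReal (1 / 2 * counterValue n₀ e (n + 1) + 1 / 4 * (2 - 3 / 2 ^ (n + 1)) +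
        D.gain u z n) := by
  rw [expectedValue_counter hD hz
    (fun s n h => (value_mem hD hu (counterValue_mem he) s n h).1) s hs, Fin.val_one,
    sum_entry_zero_one hz hD.order_pos fun t => D.value u _ t (n + 1),
    value_of_three_le (s := 3 + z * D.order) (Nat.le_add_right _ _), component_mul hz hD.order_pos]
  congr 1
  simp only [value, gain, if_true]
  ring

end Counter

/-- A bound on the probability not to have stopped. -/
def restBound (s _n : ℕ) : ℝ := if s = 0 then 4 else if s = 1 then 0 else if s = 2 then 1 else 2

theorem restBound_nonneg (s n : ℕ) : 0 ≤ restBound s n := by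
  unfold restBound
  split_ifs <;> norm_num

theorem restBound_of_three_le {s : ℕ} (h3 : 3 ≤ s) (n : ℕ) : restBound s n = 2 := by
  simp [restBound, show s ≠ 0 by omega, show s ≠ 1 by omega, show s ≠ 2 by omega]

/-- With the weights 4, 2, 1, 0 for counter, components, penultimate state and trap, the counter
contracts by exactly 3/4: half of 4 plus half of 2 is 3. A component moves to components with total
probability 1/2 and to the penultimate state with probability at most 1/2, which gives at most 3/2.
-/
theorem expectedValue_restBound (hD : D.Valid) {z : ℕ} (hz : z < 2)
    {s : Fin (3 + D.order + D.order)} (α : (mdp hD hz).EnabledAct s) {w : ℤ} (hw : 0 ≤ w) :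
    (mdp hD hz).expectedValue (ofWeight restBound) s w α.1 ≤
      ENNReal.ofReal (3 / 4) * ofWeight restBound s w := by
  have hF : ∀ s n, s < 3 + D.order + D.order → 0 ≤ restBound s n :=
    fun s n _ => restBound_nonneg s n
  obtain ⟨α, hα⟩ := α
  lift w to ℕ using hw
  rw [ofWeight_natCast, ← ENNReal.ofReal_mul (by norm_num)]
  by_cases h0 : s.1 = 0
  · rw [expectedValue_counter hD hz hF s h0]
    apply ENNReal.ofReal_le_ofReal
    obtain rfl | rfl : α = 0 ∨ α = 1 := by omega
    · rw [Fin.val_zero, sum_entry_zero_zero z hD.order_pos fun t => restBound t (w + 1),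
        restBound_of_three_le le_rfl, restBound_of_three_le (s := 3 + D.order) (Nat.le_add_right _ _), h0]
      norm_num [restBound]
    · rw [Fin.val_one, sum_entry_zero_one hz hD.order_pos fun t => restBound t (w + 1),
        restBound_of_three_le (s := 3 + z * D.order) (Nat.le_add_right _ _), h0]
      norm_num [restBound]
  · cases w with
    | zero =>
      rw [expectedValue_zero hD hz s h0]
      exact zero_le
    | succ m =>
      rw [expectedValue_succ hD hz hF s h0]
      apply ENNReal.ofReal_le_ofReal
      obtain ⟨rfl, hs1⟩ | h := (enabled_iff hD hz s α).1 hα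
      · by_cases h2 : s.1 = 2
        · rw [h2, Fin.val_zero, sum_entry_two_zero z fun t => restBound t m]
          norm_num [restBound]
        · have h3 : 3 ≤ s.1 := by omega
          rw [Fin.val_zero, hD.sum_entry_mul z h3 s.2 fun t => restBound t m,
            restBound_of_three_le h3, Finset.sum_congr rfl fun j _ => by
              rw [restBound_of_three_le (by omega), restBound_of_three_le (by omega)]]
          have hk : (D.order : ℝ) ≠ 0 := by exact_mod_cast hD.order_pos.ne'
          have hb : |((D.sign s : ℚ) * D.initial (D.component s) : ℝ)| < 1 := by
            exact_mod_cast hD.abs_sign_mul_lt s (hD.abs_initial_lt (Valid.component_lt h3 s.2))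
          have hb := abs_lt.1 hb
          push_cast at hb
          simp [restBound]
          field_simp
          linarith
      · exact absurd h h0

/-- The scheduler that takes the second action in the counter if the accumulated weight is `n₀`. -/
noncomputable def switchScheduler (hD : D.Valid) {z : ℕ} (hz : z < 2) (n₀ : ℕ) :
    (mdp hD hz).Scheduler := fun _ h hne =>
  if hs : h.last.1 = 0 then
    PMF.pure ⟨if (mdp hD hz).historyWeight h = n₀ then 1 else 0,
      (enabled_iff hD hz _ _).2 (Or.inr hs)⟩
  else PMF.pure (Classical.choice hne)

/-! ### Maximal and minimal probabilities compared with one half -/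

section Probability

variable (hD : D.Valid) {z : ℕ} (hz : z < 2) {u : ℕ → ℚ} (hu : D.Describes u)
include hD hu

/-- The correction with `e` equal to the gain at `n₀` makes the value harmonic under this scheduler,
including the step at weight `n₀`. This yields its probability exactly. -/
theorem expectedValue_switch {n₀ n : ℕ}
    (h : WeightedMDP.History (Fin (3 + D.order + D.order)) (Fin 2) n)
    (hne : Nonempty ((mdp hD hz).EnabledAct h.last)) (hs : (mdp hD hz).historySafe h)
    (α : (mdp hD hz).EnabledAct h.last)
    (hα : α ∈ (switchScheduler hD hz n₀ n h hne).support) :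
    (mdp hD hz).expectedValue (ofWeight (D.value u (counterValue n₀ (D.gain u z n₀)))) h.last
        ((mdp hD hz).historyWeight h) α.1 =
      ofWeight (D.value u (counterValue n₀ (D.gain u z n₀))) h.last
        ((mdp hD hz).historyWeight h) := by
  have he := abs_gain_le hD hu (z := z) n₀
  by_cases h0 : h.last.1 = 0
  · rw [switchScheduler, dif_pos h0] at hα
    have hα := congrArg Subtype.val ((PMF.mem_support_pure_iff _ _).1 hα)
    change α.1 = if (mdp hD hz).historyWeight h = n₀ then 1 else 0 at hα
    rw [hα]
    obtain ⟨w, hw⟩ := Int.eq_ofNat_of_zero_le hs.weight_nonneg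
    rw [hw, ofWeight_natCast]
    by_cases hn : w = n₀
    · subst hn
      rw [if_pos rfl, expectedValue_counter_second hD hz hu he h0, counterValue_step_self]
      simp [value, h0]
    · have hn' : ¬ (w : ℤ) = n₀ := by exact_mod_cast hn
      rw [if_neg hn', expectedValue_counter_first hD hz hu he h0, counterValue_step hn]
      simp [value, h0]
  · exact expectedValue_value hD hu hz (counterValue_mem he) h0 α hs.weight_nonneg

theorem value_start (n₀ : ℕ) (e : ℝ) :
    ofWeight (D.value u (counterValue n₀ e)) (mdp hD hz).init 0 =
      ENNReal.ofReal (1 / 2 + e / 2 ^ n₀) := by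
  rw [← counterValue_zero]
  exact ofWeight_natCast _ _ 0

theorem value_le_one {n₀ : ℕ} {e : ℝ} (he : |e| ≤ 1 / 2 ^ (n₀ + 1))
    (s : Fin (3 + D.order + D.order)) (w : ℤ) :
    ofWeight (D.value u (counterValue n₀ e)) s w ≤ 1 := by
  unfold ofWeight
  split_ifs
  · exact zero_le
  · exact ENNReal.ofReal_le_one.2 (value_mem hD hu (counterValue_mem he) s _ s.2).2

/-- An upper bound on the probability of the energy objective. -/
theorem pathMeasure_le {n₀ : ℕ} {e : ℝ} (he : |e| ≤ 1 / 2 ^ (n₀ + 1))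
    (𝔖 : (mdp hD hz).Scheduler)
    (hstep : ∀ (n : ℕ) (h : WeightedMDP.History _ _ n)
      (hne : Nonempty ((mdp hD hz).EnabledAct h.last)),
      (mdp hD hz).historySafe h → ∀ α ∈ (𝔖 n h hne).support,
        (mdp hD hz).expectedValue (ofWeight (D.value u (counterValue n₀ e))) h.last
          ((mdp hD hz).historyWeight h) α.1 ≤
        ofWeight (D.value u (counterValue n₀ e)) h.last ((mdp hD hz).historyWeight h)) :
    (mdp hD hz).pathMeasure 𝔖 (mdp hD hz).energyObjective ≤
      ENNReal.ofReal (1 / 2 + e / 2 ^ n₀) := by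
  rw [← value_start hD hz hu]
  refine (mdp hD hz).pathMeasure_le_of_superharmonic 𝔖 _ (ofWeight restBound)
    (ENNReal.ofReal (3 / 4)) (by norm_num) (ofWeight_neg _) (ofWeight_neg _) ?_ ?_ ?_ hstep ?_
  · intro s w hw
    lift w to ℕ using hw
    rw [ofWeight_natCast, ofWeight_natCast, ← ENNReal.ofReal_add
      (value_mem hD hu (counterValue_mem he) s _ s.2).1 (restBound_nonneg _ _),
      ENNReal.one_le_ofReal]
    have := (value_mem hD hu (counterValue_mem he) s w s.2).1
    by_cases h1 : s.1 = 1
    · simp [value, restBound, h1]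
    · have : 1 ≤ restBound s w := by
        unfold restBound
        split_ifs <;> norm_num
      linarith
  · unfold ofWeight
    split_ifs <;> simp
  · intro s w hs
    have h1 : s.1 = 1 := by
      by_contra h1
      exact hs ⟨⟨0, (enabled_iff hD hz s 0).2 (Or.inl ⟨rfl, h1⟩)⟩⟩
    simp [ofWeight, restBound, h1]
  · intro n h hne hs α _
    exact expectedValue_restBound hD hz α hs.weight_nonneg

/-- A lower bound on the probability of the energy objective. -/
theorem le_pathMeasure {n₀ : ℕ} {e : ℝ} (he : |e| ≤ 1 / 2 ^ (n₀ + 1))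
    (𝔖 : (mdp hD hz).Scheduler)
    (hstep : ∀ (n : ℕ) (h : WeightedMDP.History _ _ n)
      (hne : Nonempty ((mdp hD hz).EnabledAct h.last)),
      (mdp hD hz).historySafe h → ∀ α ∈ (𝔖 n h hne).support,
        ofWeight (D.value u (counterValue n₀ e)) h.last ((mdp hD hz).historyWeight h) ≤
        (mdp hD hz).expectedValue (ofWeight (D.value u (counterValue n₀ e))) h.last
          ((mdp hD hz).historyWeight h) α.1) :
    ENNReal.ofReal (1 / 2 + e / 2 ^ n₀) ≤
      (mdp hD hz).pathMeasure 𝔖 (mdp hD hz).energyObjective := by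
  rw [← value_start hD hz hu]
  exact (mdp hD hz).le_pathMeasure_of_subharmonic 𝔖 _ (ofWeight_neg _)
    (value_le_one hD hu he) hstep

theorem pathMeasure_switch (n₀ : ℕ) :
    (mdp hD hz).pathMeasure (switchScheduler hD hz n₀) (mdp hD hz).energyObjective =
      ENNReal.ofReal (1 / 2 + D.gain u z n₀ / 2 ^ n₀) :=
  le_antisymm
    (pathMeasure_le hD hz hu (abs_gain_le hD hu n₀) _ fun _ h hne hs α hα =>
      (expectedValue_switch hD hz hu h hne hs α hα).le)
    (le_pathMeasure hD hz hu (abs_gain_le hD hu n₀) _ fun _ h hne hs α hα =>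
      (expectedValue_switch hD hz hu h hne hs α hα).ge)

/-- With zero correction, `value` belongs to the scheduler that only uses the first action. The
second action of the counter is then the sole deviation from harmonicity, and it deviates by the
gain. If the gain has a constant sign, the function is super- or subharmonic for every scheduler. -/
theorem expectedValue_cases {s : Fin (3 + D.order + D.order)}
    (α : (mdp hD hz).EnabledAct s) {w : ℤ} (hw : 0 ≤ w) :
    (mdp hD hz).expectedValue (ofWeight (D.value u (counterValue 0 0))) s w α.1 =
        ofWeight (D.value u (counterValue 0 0)) s w ∨
      ∃ n : ℕ, ofWeight (D.value u (counterValue 0 0)) s w =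
          ENNReal.ofReal (counterValue 0 0 n) ∧
        (mdp hD hz).expectedValue (ofWeight (D.value u (counterValue 0 0))) s w α.1 =
          ENNReal.ofReal (counterValue 0 0 n + D.gain u z n) := by
  have he : |(0 : ℝ)| ≤ 1 / 2 ^ (0 + 1) := by norm_num
  by_cases h0 : s.1 = 0
  · lift w to ℕ using hw
    have hstep : 1 / 2 * counterValue 0 0 (w + 1) + 1 / 4 * (2 - 3 / 2 ^ (w + 1)) =
        counterValue 0 0 w := by
      have := counterValue_step_self 0 0
      by_cases hw : w = 0
      · subst hw
        simpa using this
      · exact counterValue_step hw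
    have hv : ofWeight (D.value u (counterValue 0 0)) s (w : ℤ) =
        ENNReal.ofReal (counterValue 0 0 w) := by
      rw [ofWeight_natCast]
      simp [value, h0]
    obtain h | h : α.1 = 0 ∨ α.1 = 1 := by omega
    · left
      rw [h, expectedValue_counter_first hD hz hu he h0, hstep, hv]
    · right
      exact ⟨w, hv, by rw [h, expectedValue_counter_second hD hz hu he h0, hstep]⟩
  · exact Or.inl (expectedValue_value hD hu hz (counterValue_mem he) h0 α hw)

theorem pathMeasure_le_half (hg : ∀ n, D.gain u z n ≤ 0) (𝔖 : (mdp hD hz).Scheduler) :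
    (mdp hD hz).pathMeasure 𝔖 (mdp hD hz).energyObjective ≤ ENNReal.ofReal (1 / 2) := by
  have := pathMeasure_le hD hz hu (n₀ := 0) (e := 0) (by norm_num) 𝔖 fun n h hne hs α _ => ?_
  · simpa using this
  · obtain h | ⟨m, h1, h2⟩ := expectedValue_cases hD hz hu α hs.weight_nonneg
    · exact h.le
    · rw [h1, h2]
      exact ENNReal.ofReal_le_ofReal (by linarith [hg m])

theorem half_le_pathMeasure (hg : ∀ n, 0 ≤ D.gain u z n) (𝔖 : (mdp hD hz).Scheduler) :
    ENNReal.ofReal (1 / 2) ≤ (mdp hD hz).pathMeasure 𝔖 (mdp hD hz).energyObjective := by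
  have := le_pathMeasure hD hz hu (n₀ := 0) (e := 0) (by norm_num) 𝔖 fun n h hne hs α _ => ?_
  · simpa using this
  · obtain h | ⟨m, h1, h2⟩ := expectedValue_cases hD hz hu α hs.weight_nonneg
    · exact h.ge
    · rw [h1, h2]
      exact ENNReal.ofReal_le_ofReal (by linarith [hg m])

omit hu in
theorem gain_eq (hz : z < 2) (n : ℕ) : ∃ c : ℝ, 0 < c ∧
    D.gain u z n = (if z = 0 then 1 else -1) * (c * u n) := by
  have hZ : (0 : ℝ) < D.scale := by exact_mod_cast one_pos.trans hD.one_lt_scale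
  have hk : (0 : ℝ) < D.order := by exact_mod_cast hD.order_pos
  refine ⟨1 / (2 * D.scale) / (2 * D.order * D.scale) ^ n / 4, by positivity, ?_⟩
  rw [gain, sign_mul hz hD.order_pos, vec, add_zero]
  push_cast
  ring

/-- If the second action leads to the negated component, then the maximal probability exceeds `1/2`
if and only if some member of the sequence is negative. -/
theorem half_lt_prMax_iff : ENNReal.ofReal (1 / 2) <
    (mdp hD one_lt_two).prMax (mdp hD one_lt_two).energyObjective ↔ ∃ n, u n < 0 := by
  constructor
  · intro h
    by_contra! hn
    refine h.not_ge (iSup_le fun 𝔖 => pathMeasure_le_half hD one_lt_two hu (fun n => ?_) 𝔖)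
    obtain ⟨c, hc, he⟩ := gain_eq hD (u := u) one_lt_two n
    have : (0 : ℝ) ≤ u n := by exact_mod_cast hn n
    have := mul_nonneg hc.le this
    rw [he]
    simpa
  · rintro ⟨n, hn⟩
    refine lt_of_lt_of_le ?_ (le_iSup _ (switchScheduler hD one_lt_two n))
    rw [pathMeasure_switch hD one_lt_two hu]
    obtain ⟨c, hc, he⟩ := gain_eq hD (u := u) one_lt_two n
    have : (u n : ℝ) < 0 := by exact_mod_cast hn
    have := mul_neg_of_pos_of_neg hc this
    have hg : 0 < D.gain u 1 n / 2 ^ n := by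
      rw [he]
      exact div_pos (by simpa using this) (by positivity)
    exact (ENNReal.ofReal_lt_ofReal_iff (by linarith)).2 (by linarith)

/-- If the second action leads to the component itself, then the minimal probability is below `1/2`
if and only if some member of the sequence is negative. -/
theorem prMin_lt_half_iff : (mdp hD two_pos).prMin (mdp hD two_pos).energyObjective <
    ENNReal.ofReal (1 / 2) ↔ ∃ n, u n < 0 := by
  constructor
  · intro h
    by_contra! hn
    refine h.not_ge (le_iInf fun 𝔖 => half_le_pathMeasure hD two_pos hu (fun n => ?_) 𝔖)
    obtain ⟨c, hc, he⟩ := gain_eq hD (u := u) two_pos n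
    have : (0 : ℝ) ≤ u n := by exact_mod_cast hn n
    have := mul_nonneg hc.le this
    rw [he]
    simpa
  · rintro ⟨n, hn⟩
    refine lt_of_le_of_lt (iInf_le _ (switchScheduler hD two_pos n)) ?_
    rw [pathMeasure_switch hD two_pos hu]
    obtain ⟨c, hc, he⟩ := gain_eq hD (u := u) two_pos n
    have : (u n : ℝ) < 0 := by exact_mod_cast hn
    have := mul_neg_of_pos_of_neg hc this
    have hg : D.gain u 0 n / 2 ^ n < 0 := by
      rw [he]
      simp only [if_true, one_mul]
      exact div_neg_of_neg_of_pos this (by positivity)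
    exact (ENNReal.ofReal_lt_ofReal_iff (by norm_num)).2 (by linarith)

end Probability

end ScaledLRS

/-! ### Binary lengths and the cost of loop-free programs -/

namespace LogRAM

theorem one_le_bitLength (z : ℤ) : 1 ≤ bitLength z := Nat.le_add_left _ _

theorem bitLength_le_iff {z : ℤ} {B : ℕ} : bitLength z ≤ B + 1 ↔ z.natAbs < 2 ^ B := by
  rw [bitLength, Nat.add_le_add_iff_right, Nat.size_le]

theorem natAbs_lt_two_pow (z : ℤ) : z.natAbs < 2 ^ (bitLength z - 1) := by
  rw [bitLength, Nat.add_sub_cancel]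
  exact Nat.lt_size_self _

theorem bitLength_mono {x y : ℤ} (h : x.natAbs ≤ y.natAbs) : bitLength x ≤ bitLength y :=
  Nat.add_le_add_right (Nat.size_le_size h) 1

/-- The bound is crude for sums but has the same form as the one for products, so that one notion of
size serves all operations. -/
theorem bitLength_le_of_natAbs_add {x y z : ℤ} (h : z.natAbs ≤ x.natAbs + y.natAbs) :
    bitLength z ≤ bitLength x + bitLength y := by
  have hx := natAbs_lt_two_pow x
  have hy := natAbs_lt_two_pow y
  obtain ⟨a, ha⟩ := Nat.exists_eq_add_of_le' (one_le_bitLength x)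
  obtain ⟨b, hb⟩ := Nat.exists_eq_add_of_le' (one_le_bitLength y)
  rw [ha, hb, show a + 1 + (b + 1) = a + b + 1 + 1 by ring, bitLength_le_iff]
  rw [ha, Nat.add_sub_cancel] at hx
  rw [hb, Nat.add_sub_cancel] at hy
  have h1 : 2 ^ a ≤ 2 ^ (a + b) := Nat.pow_le_pow_right two_pos (by omega)
  have h2 : 2 ^ b ≤ 2 ^ (a + b) := Nat.pow_le_pow_right two_pos (by omega)
  rw [pow_succ]
  omega

theorem bitLength_add_le (x y : ℤ) : bitLength (x + y) ≤ bitLength x + bitLength y :=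
  bitLength_le_of_natAbs_add (Int.natAbs_add_le x y)

theorem bitLength_sub_le (x y : ℤ) : bitLength (x - y) ≤ bitLength x + bitLength y :=
  bitLength_le_of_natAbs_add (Int.natAbs_sub_le x y)

theorem bitLength_mul_le (x y : ℤ) : bitLength (x * y) ≤ bitLength x + bitLength y := by
  have hx := natAbs_lt_two_pow x
  have hy := natAbs_lt_two_pow y
  obtain ⟨a, ha⟩ := Nat.exists_eq_add_of_le' (one_le_bitLength x)
  obtain ⟨b, hb⟩ := Nat.exists_eq_add_of_le' (one_le_bitLength y)
  rw [ha, hb, show a + 1 + (b + 1) = a + b + 1 + 1 by ring, bitLength_le_iff, Int.natAbs_mul]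
  rw [ha, Nat.add_sub_cancel] at hx
  rw [hb, Nat.add_sub_cancel] at hy
  calc _ < 2 ^ a * 2 ^ b := Nat.mul_lt_mul'' hx hy
    _ ≤ _ := by
      rw [← pow_add]
      exact Nat.pow_le_pow_right two_pos (by omega)

theorem bitLength_div_le (x y : ℤ) : bitLength (x / y) ≤ bitLength x :=
  bitLength_mono (by
    have := Int.abs_ediv_le_abs x y
    rw [Int.abs_eq_natAbs, Int.abs_eq_natAbs] at this
    exact_mod_cast this)

theorem bitLength_natCast_le (n : ℕ) : bitLength n ≤ n + 1 :=
  bitLength_le_iff.2 (by simpa using Nat.lt_two_pow_self)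

/-- All registers and all cells have binary length at most `B`. -/
structure Bd (σ : State) (B : ℕ) : Prop where
  reg : ∀ x, bitLength (σ.reg x) ≤ B
  mem : ∀ a i, bitLength (σ.mem a i) ≤ B

theorem Bd.one_le {σ : State} {B : ℕ} (h : Bd σ B) : 1 ≤ B := (one_le_bitLength _).trans (h.reg 0)

theorem Bd.mono {σ : State} {B B' : ℕ} (h : Bd σ B) (hB : B ≤ B') : Bd σ B' :=
  ⟨fun x => (h.reg x).trans hB, fun a i => (h.mem a i).trans hB⟩

namespace Expr

/-- The factor by which the values of an expression can be longer than the values it reads. -/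
def size : Expr → ℕ
  | const c => bitLength c
  | var _ => 1
  | get _ e => e.size + 1
  | add e₁ e₂ => e₁.size + e₂.size
  | sub e₁ e₂ => e₁.size + e₂.size
  | mul e₁ e₂ => e₁.size + e₂.size
  | div e₁ e₂ => e₁.size + e₂.size

theorem one_le_size (e : Expr) : 1 ≤ e.size := by
  induction e <;> simp only [size] <;> first | exact one_le_bitLength _ | omega

theorem bitLength_eval_le {σ : State} {B : ℕ} (h : Bd σ B) (e : Expr) :
    bitLength (e.eval σ) ≤ e.size * B := by
  have h1 := h.one_le
  induction e with
  | const c => exact Nat.le_mul_of_pos_right _ h1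
  | var x => simpa [size, eval] using h.reg x
  | get a e _ => exact (h.mem _ _).trans (Nat.le_mul_of_pos_left _ (Nat.succ_pos _))
  | add e₁ e₂ ih₁ ih₂ =>
    rw [size, add_mul]
    exact (bitLength_add_le _ _).trans (add_le_add ih₁ ih₂)
  | sub e₁ e₂ ih₁ ih₂ =>
    rw [size, add_mul]
    exact (bitLength_sub_le _ _).trans (add_le_add ih₁ ih₂)
  | mul e₁ e₂ ih₁ ih₂ =>
    rw [size, add_mul]
    exact (bitLength_mul_le _ _).trans (add_le_add ih₁ ih₂)
  | div e₁ e₂ ih₁ ih₂ =>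
    rw [size, add_mul]
    exact (bitLength_div_le _ _).trans (ih₁.trans (Nat.le_add_right _ _))

theorem cost_le {σ : State} {B : ℕ} (h : Bd σ B) (e : Expr) : e.cost σ ≤ e.size ^ 2 * B := by
  have h1 := h.one_le
  -- Sizes are at least 1, so `s₁ + s₂ ≤ 2 * s₁ * s₂`. The square of the size thus absorbs the cost
  -- of the result in addition to the costs of the operands.
  have key : ∀ s₁ s₂ c₁ c₂ v : ℕ, 1 ≤ s₁ → 1 ≤ s₂ → c₁ ≤ s₁ ^ 2 * B → c₂ ≤ s₂ ^ 2 * B →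
      v ≤ (s₁ + s₂) * B → c₁ + c₂ + v ≤ (s₁ + s₂) ^ 2 * B := by
    intro s₁ s₂ c₁ c₂ v hs₁ hs₂ h₁ h₂ hv
    have : s₁ ^ 2 + s₂ ^ 2 + (s₁ + s₂) ≤ (s₁ + s₂) ^ 2 := by nlinarith
    calc _ ≤ s₁ ^ 2 * B + s₂ ^ 2 * B + (s₁ + s₂) * B := add_le_add (add_le_add h₁ h₂) hv
      _ = (s₁ ^ 2 + s₂ ^ 2 + (s₁ + s₂)) * B := by ring
      _ ≤ _ := Nat.mul_le_mul_right _ this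
  induction e with
  | const c =>
    simp only [cost, size]
    have := one_le_bitLength c
    calc bitLength c ≤ bitLength c ^ 2 := Nat.le_self_pow two_ne_zero _
      _ ≤ _ := Nat.le_mul_of_pos_right _ h1
  | var x => simpa [cost, size] using h.reg x
  | get a e ih =>
    simp only [cost, size]
    calc _ ≤ e.size ^ 2 * B + B := add_le_add ih (h.mem _ _)
      _ = (e.size ^ 2 + 1) * B := by ring
      _ ≤ _ := Nat.mul_le_mul_right _ (by
        rw [add_sq]
        omega)
  | add e₁ e₂ ih₁ ih₂ =>
    exact key _ _ _ _ _ e₁.one_le_size e₂.one_le_size ih₁ ih₂ (bitLength_eval_le h (add e₁ e₂))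
  | sub e₁ e₂ ih₁ ih₂ =>
    exact key _ _ _ _ _ e₁.one_le_size e₂.one_le_size ih₁ ih₂ (bitLength_eval_le h (sub e₁ e₂))
  | mul e₁ e₂ ih₁ ih₂ =>
    exact key _ _ _ _ _ e₁.one_le_size e₂.one_le_size ih₁ ih₂ (bitLength_eval_le h (mul e₁ e₂))
  | div e₁ e₂ ih₁ ih₂ =>
    exact key _ _ _ _ _ e₁.one_le_size e₂.one_le_size ih₁ ih₂ (bitLength_eval_le h (div e₁ e₂))

end Expr

namespace Prog

/-- Programs without loops. -/
def LoopFree : Prog → Prop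
  | seq c d => c.LoopFree ∧ d.LoopFree
  | ifPos _ c d => c.LoopFree ∧ d.LoopFree
  | loopPos _ _ => False
  | _ => True

/-- The final state of a program without loops. -/
def exec : Prog → State → State
  | skip, σ => σ
  | assign x e, σ => { σ with reg := Function.update σ.reg x (e.eval σ) }
  | store a i e, σ =>
    { σ with mem := Function.update σ.mem a (Function.update (σ.mem a) (i.eval σ) (e.eval σ)) }
  | emit e, σ => { σ with out := σ.out ++ [e.eval σ] }
  | seq c d, σ => d.exec (c.exec σ)
  | ifPos e c d, σ => if 0 < e.eval σ then c.exec σ else d.exec σ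
  | loopPos _ _, σ => σ

/-- The factor by which a program without loops can lengthen the values. -/
def growth : Prog → ℕ
  | assign _ e => e.size
  | store _ _ e => e.size
  | seq c d => c.growth * d.growth
  | ifPos _ c d => c.growth * d.growth
  | _ => 1

/-- The cost of a program without loops, relative to the length of the values. -/
def weight : Prog → ℕ
  | assign _ e => e.size ^ 2 + 1
  | store _ i e => i.size ^ 2 + e.size ^ 2 + 1
  | emit e => e.size ^ 2 + 1
  | seq c d => c.weight + d.weight * c.growth
  | ifPos e c d => e.size ^ 2 + 1 + c.weight + d.weight
  | _ => 1

theorem one_le_growth (c : Prog) : 1 ≤ c.growth := by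
  induction c <;> simp only [growth, le_refl] <;>
    first | exact Expr.one_le_size _ | exact Nat.mul_pos ‹_› ‹_›

/-- Only registers that satisfy `p` are changed, and there are no loops. -/
def AssignsOnly (p : ℕ → Bool) : Prog → Bool
  | skip => true
  | assign x _ => p x
  | seq c d => c.AssignsOnly p && d.AssignsOnly p
  | ifPos _ c d => c.AssignsOnly p && d.AssignsOnly p
  | _ => false

theorem AssignsOnly.loopFree {p : ℕ → Bool} {c : Prog} (h : c.AssignsOnly p = true) :
    c.LoopFree := by
  induction c <;> simp_all [AssignsOnly, LoopFree]

theorem AssignsOnly.exec_reg {p : ℕ → Bool} {c : Prog} (h : c.AssignsOnly p = true) (σ : State)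
    {x : ℕ} (hx : p x = false) : (c.exec σ).reg x = σ.reg x := by
  induction c generalizing σ with
  | assign y e =>
    have : x ≠ y := by
      rintro rfl
      simp_all [AssignsOnly]
    simp [exec, Function.update_of_ne this]
  | ifPos e c d ihc ihd =>
    simp only [AssignsOnly, Bool.and_eq_true] at h
    simp only [exec]
    split_ifs
    · exact ihc h.1 σ
    · exact ihd h.2 σ
  | _ => simp_all [AssignsOnly, exec]

theorem AssignsOnly.exec_mem {p : ℕ → Bool} {c : Prog} (h : c.AssignsOnly p = true) (σ : State) :
    (c.exec σ).mem = σ.mem := by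
  induction c generalizing σ with
  | ifPos e c d ihc ihd =>
    simp only [AssignsOnly, Bool.and_eq_true] at h
    simp only [exec]
    split_ifs
    · exact ihc h.1 σ
    · exact ihd h.2 σ
  | _ => simp_all [AssignsOnly, exec]

theorem AssignsOnly.exec_out {p : ℕ → Bool} {c : Prog} (h : c.AssignsOnly p = true) (σ : State) :
    (c.exec σ).out = σ.out := by
  induction c generalizing σ with
  | ifPos e c d ihc ihd =>
    simp only [AssignsOnly, Bool.and_eq_true] at h
    simp only [exec]
    split_ifs
    · exact ihc h.1 σ
    · exact ihd h.2 σ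
  | _ => simp_all [AssignsOnly, exec]

/-- The factors `weight` and `growth` depend on the program only, so a fixed loop-free program has
linear cost and lengthens the values by a constant factor. -/
theorem LoopFree.run {c : Prog} (hc : c.LoopFree) {σ : State} {B : ℕ} (h : Bd σ B) :
    ∃ t, Run c σ (c.exec σ) t ∧ t ≤ c.weight * B ∧ Bd (c.exec σ) (c.growth * B) := by
  induction c generalizing σ B with
  | skip => exact ⟨1, .skip σ, by simpa [weight] using h.one_le, by simpa [growth, exec] using h⟩
  | assign x e =>
    refine ⟨_, .assign σ x e, ?_, ?_, ?_⟩
    · rw [weight, add_mul]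
      have := h.one_le
      exact add_le_add (Expr.cost_le h e) (by omega)
    · intro y
      simp only [exec, Function.update_apply]
      split_ifs
      · exact Expr.bitLength_eval_le h e
      · exact (h.reg y).trans (Nat.le_mul_of_pos_left _ e.one_le_size)
    · intro a i
      exact (h.mem a i).trans (Nat.le_mul_of_pos_left _ e.one_le_size)
  | store a i e =>
    refine ⟨_, .store σ a i e, ?_, ?_, ?_⟩
    · rw [weight, add_mul, add_mul]
      have := h.one_le
      exact add_le_add (add_le_add (Expr.cost_le h i) (Expr.cost_le h e)) (by omega)
    · intro y
      exact (h.reg y).trans (Nat.le_mul_of_pos_left _ e.one_le_size)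
    · intro b j
      have hb := (h.mem b j).trans (Nat.le_mul_of_pos_left B e.one_le_size)
      simp only [exec, Function.update_apply]
      split_ifs with hab
      · subst hab
        rw [Function.update_apply]
        split_ifs
        · exact Expr.bitLength_eval_le h e
        · exact hb
      · exact hb
  | emit e =>
    refine ⟨_, .emit σ e, ?_, by simpa [growth] using ⟨h.reg, h.mem⟩⟩
    rw [weight, add_mul]
    have := h.one_le
    exact add_le_add (Expr.cost_le h e) (by omega)
  | seq c d ihc ihd =>
    obtain ⟨t, h1, h2, h3⟩ := ihc hc.1 h
    obtain ⟨u, k1, k2, k3⟩ := ihd hc.2 h3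
    refine ⟨t + u, .seq h1 k1, ?_, ?_⟩
    · rw [weight, add_mul, mul_assoc]
      exact add_le_add h2 k2
    · rw [growth, mul_comm c.growth, mul_assoc]
      exact k3
  | ifPos e c d ihc ihd =>
    have hcost := Expr.cost_le h e
    have h1 := h.one_le
    have gc := c.one_le_growth
    have gd := d.one_le_growth
    by_cases he : 0 < e.eval σ
    · obtain ⟨t, k1, k2, k3⟩ := ihc hc.1 h
      simp only [exec, he, if_true]
      refine ⟨_, .ifPos he k1, ?_, k3.mono (Nat.mul_le_mul_right _ (Nat.le_mul_of_pos_right _ gd))⟩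
      simp only [weight, add_mul]
      omega
    · obtain ⟨t, k1, k2, k3⟩ := ihd hc.2 h
      simp only [exec, he, if_false]
      refine ⟨_, .ifNonpos (not_lt.1 he) k1, ?_,
        k3.mono (Nat.mul_le_mul_right _ (Nat.le_mul_of_pos_left _ gc))⟩
      simp only [weight, add_mul]
      omega
  | loopPos e c => exact hc.elim

end Prog

/-! ### Loops and Euclid's algorithm -/

/-- Started in `σ`, the program `c` halts in `τ` with a cost of at most `T`. -/
def Reaches (c : Prog) (σ τ : State) (T : ℕ) : Prop := ∃ t, Run c σ τ t ∧ t ≤ T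

theorem Reaches.mono {c : Prog} {σ τ : State} {T U : ℕ} (h : Reaches c σ τ T) (hTU : T ≤ U) :
    Reaches c σ τ U :=
  let ⟨t, h1, h2⟩ := h
  ⟨t, h1, h2.trans hTU⟩

theorem Reaches.seq {c d : Prog} {σ τ ρ : State} {T U : ℕ} (h : Reaches c σ τ T)
    (k : Reaches d τ ρ U) : Reaches (.seq c d) σ ρ (T + U) :=
  let ⟨_, h1, h2⟩ := h
  let ⟨_, k1, k2⟩ := k
  ⟨_, .seq h1 k1, add_le_add h2 k2⟩

theorem Prog.LoopFree.reaches {c : Prog} (hc : c.LoopFree) {σ τ : State} {B : ℕ} (h : Bd σ B)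
    (hτ : c.exec σ = τ) : Reaches c σ τ (c.weight * B) :=
  let ⟨t, h1, h2, _⟩ := hc.run h
  ⟨t, hτ ▸ h1, h2⟩

/-- A loop that passes through the states `S 0, …, S n`. -/
theorem Reaches.loop {e : Expr} {c : Prog} (S : ℕ → State) {n T B : ℕ}
    (hB : ∀ i ≤ n, Bd (S i) B) (hpos : ∀ i < n, 0 < e.eval (S i)) (hend : e.eval (S n) ≤ 0)
    (hstep : ∀ i < n, Reaches c (S i) (S (i + 1)) T) :
    Reaches (.loopPos e c) (S 0) (S n) ((n + 1) * (e.size ^ 2 * B + 1 + T)) := by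
  -- Induction on the number `m` of remaining rounds, because the rule for loops adds rounds at the
  -- front.
  have key : ∀ m ≤ n, Reaches (.loopPos e c) (S (n - m)) (S n)
      ((m + 1) * (e.size ^ 2 * B + 1 + T)) := by
    intro m hm
    induction m with
    | zero =>
      refine ⟨_, .loopStop hend, ?_⟩
      have := Expr.cost_le (hB n le_rfl) e
      rw [Nat.sub_zero]
      omega
    | succ m ih =>
      obtain ⟨t, h1, h2⟩ := hstep (n - (m + 1)) (by omega)
      obtain ⟨u, k1, k2⟩ := ih (by omega)
      rw [show n - (m + 1) + 1 = n - m by omega] at h1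
      refine ⟨_, .loopStep (hpos _ (by omega)) h1 k1, ?_⟩
      have := Expr.cost_le (hB (n - (m + 1)) (by omega)) e
      rw [add_mul (m + 1) 1]
      omega
  simpa using key n le_rfl

/-- Euclid's algorithm on the registers `x` and `y` with the auxiliary register `z`. -/
def euclid (x y z : ℕ) : Prog :=
  .loopPos (.var y) (.seq (.assign z (.sub (.var x) (.mul (.div (.var x) (.var y)) (.var y))))
    (.seq (.assign x (.var y)) (.assign y (.var z))))

/-- The same bound `B` holds before and after the step, since remainder, quotient and quotient times
divisor are at most `a`. The general estimate for loop-free programs would multiply `B` by a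
constant in every round, which is exponential over the whole loop. -/
theorem euclid_step {x y z : ℕ} (hxy : x ≠ y) (hxz : x ≠ z) (hyz : y ≠ z) {σ : State} {a b B : ℕ}
    (hB : Bd σ B) (hx : σ.reg x = a) (hy : σ.reg y = b) :
    ∃ τ, Reaches (.seq (.assign z (.sub (.var x) (.mul (.div (.var x) (.var y)) (.var y))))
        (.seq (.assign x (.var y)) (.assign y (.var z)))) σ τ (20 * B) ∧ Bd τ B ∧
      τ.reg x = b ∧ τ.reg y = (a % b : ℕ) ∧ τ.mem = σ.mem ∧ τ.out = σ.out ∧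
      ∀ r, r ≠ x → r ≠ y → r ≠ z → τ.reg r = σ.reg r := by
  set c : Prog := .seq (.assign z (.sub (.var x) (.mul (.div (.var x) (.var y)) (.var y))))
        (.seq (.assign x (.var y)) (.assign y (.var z))) with hc
  have hmod : (a : ℤ) - (a : ℤ) / b * b = (a % b : ℕ) := by
    rw [Int.natCast_mod, Int.emod_def, mul_comm]
  have ha : bitLength (a : ℤ) ≤ B := hx ▸ hB.reg x
  have hb : bitLength (b : ℤ) ≤ B := hy ▸ hB.reg y
  have hm : bitLength ((a % b : ℕ) : ℤ) ≤ B :=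
    (bitLength_mono (x := ((a % b : ℕ) : ℤ)) (y := a) (Nat.mod_le a b)).trans ha
  have hreg : (c.exec σ).reg =
      Function.update (Function.update (Function.update σ.reg z (a % b : ℕ)) x b) y
        (a % b : ℕ) := by
    simp [hc, Prog.exec, Expr.eval, hx, hy, hyz, hxz.symm, hmod]
  have hq : bitLength ((a : ℤ) / b) ≤ B := (bitLength_div_le _ _).trans ha
  have hqb : bitLength ((a : ℤ) / b * b) ≤ B := by
    refine (bitLength_mono ?_).trans ha
    rw [← Int.natCast_div, ← Int.natCast_mul]
    exact Nat.div_mul_le_self a b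
  refine ⟨c.exec σ, ⟨_, .seq (.assign _ _ _) (.seq (.assign _ _ _) (.assign _ _ _)), ?_⟩,
    ⟨fun r => ?_, hB.mem⟩, ?_, ?_, rfl, rfl, fun r h1 h2 h3 => ?_⟩
  · have h1 := hB.one_le
    simp [Expr.cost, Expr.eval, hx, hy, hyz, hxz.symm, hmod] at *
    omega
  · rw [hreg]
    simp only [Function.update_apply]
    split_ifs
    · exact hm
    · exact hb
    · exact hm
    · exact hB.reg r
  · simp [hreg, hxy]
  · simp [hreg]
  · simp [hreg, h1, h2, h3]

/-- As `b ≤ a`, the remainder is less than `a / 2`, so each round more than halves the product of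
the two registers while it is positive. The number of rounds is thus at most its logarithm. -/
theorem euclid_reaches {x y z : ℕ} (hxy : x ≠ y) (hxz : x ≠ z) (hyz : y ≠ z) {B : ℕ} (n : ℕ)
    {σ : State} {a b : ℕ} (hba : b ≤ a) (hab : a * b < 2 ^ n) (hB : Bd σ B) (hx : σ.reg x = a)
    (hy : σ.reg y = b) :
    ∃ τ, Reaches (euclid x y z) σ τ ((n + 1) * (23 * B)) ∧ Bd τ B ∧
      τ.reg x = Nat.gcd a b ∧ τ.mem = σ.mem ∧ τ.out = σ.out ∧
      ∀ r, r ≠ x → r ≠ y → r ≠ z → τ.reg r = σ.reg r := by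
  have h1 := hB.one_le
  have hcost : (Expr.var y).cost σ ≤ B := hB.reg y
  induction n generalizing σ a b with
  | zero =>
    obtain rfl : b = 0 := by
      have : a * b = 0 := by omega
      rcases Nat.mul_eq_zero.1 this with h | h <;> omega
    refine ⟨σ, ⟨_, .loopStop (by simp [Expr.eval, hy]), by omega⟩, hB, by simpa using hx, rfl, rfl,
      fun _ _ _ _ => rfl⟩
  | succ n ih =>
    rcases Nat.eq_zero_or_pos b with rfl | hb
    · refine ⟨σ, ⟨_, .loopStop (by simp [Expr.eval, hy]), ?_⟩, hB, by simpa using hx, rfl, rfl,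
        fun _ _ _ _ => rfl⟩
      rw [add_mul (n + 1)]
      omega
    · obtain ⟨τ, ⟨t, ht, hT⟩, hτB, hτx, hτy, hτm, hτo, hτr⟩ :=
        euclid_step hxy hxz hyz hB hx hy
      have hmod : 2 * (a % b) < a := by
        have h1 := Nat.mod_add_div a b
        have h2 := Nat.mod_lt a hb
        have h3 : 1 ≤ a / b := Nat.div_pos hba hb
        have : b * 1 ≤ b * (a / b) := Nat.mul_le_mul_left _ h3
        omega
      have hlt : b * (a % b) < 2 ^ n := by
        have : b * (2 * (a % b)) < b * a := Nat.mul_lt_mul_of_pos_left hmod hb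
        rw [pow_succ] at hab
        nlinarith
      obtain ⟨ρ, ⟨u, hu, hU⟩, hρB, hρx, hρm, hρo, hρr⟩ :=
        ih (Nat.mod_lt a hb).le hlt hτB hτx hτy (hτB.reg y)
      refine ⟨ρ, ⟨_, .loopStep (by simp [Expr.eval, hy, hb]) ht hu, ?_⟩, hρB, ?_,
        hρm.trans hτm, hρo.trans hτo, fun r h1 h2 h3 => (hρr r h1 h2 h3).trans (hτr r h1 h2 h3)⟩
      · rw [add_mul (n + 1)]
        omega
      · rw [hρx, Nat.gcd_comm a b, Nat.gcd_rec b a, Nat.gcd_comm]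

/-- The encoding demands lowest terms, which is why the program has to compute greatest common
divisors. -/
theorem encodeRat_div {n d : ℕ} (hd : 0 < d) :
    encodeRat ((n : ℚ) / d) = [(n : ℤ) / Nat.gcd d n, (d : ℤ) / Nat.gcd d n] := by
  obtain ⟨g, n', d', hg, hcop, hn, hd'⟩ := Nat.exists_coprime' (m := n) (n := d)
    (Nat.gcd_pos_of_pos_right _ hd)
  have hd0 : 0 < d' := Nat.pos_of_ne_zero fun h => by simp [h] at hd'; omega
  have hgcd : Nat.gcd d n = g := by
    rw [hn, hd', Nat.gcd_mul_right, hcop.symm.gcd_eq_one, one_mul]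
  have hq : (n : ℚ) / d = ((n' : ℤ) : ℚ) / ((d' : ℤ) : ℚ) := by
    have : (g : ℚ) ≠ 0 := by exact_mod_cast hg.ne'
    rw [hn, hd']
    push_cast
    field_simp
  have hg' : (g : ℤ) ≠ 0 := by exact_mod_cast hg.ne'
  rw [hgcd, encodeRat, hq, Rat.num_div_eq_of_coprime (by exact_mod_cast hd0) (by simpa using hcop),
    Rat.den_div_eq_of_coprime (by exact_mod_cast hd0) (by simpa using hcop), hn, hd']
  push_cast
  rw [Int.mul_ediv_cancel _ hg', Int.mul_ediv_cancel _ hg']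

end LogRAM

/-! ### Reading a recurrence from its encoding -/

namespace ScaledLRS

/-- The linear recurrence that is encoded by a list. -/
def ofList (l : List ℤ) : ScaledLRS where
  order := (l.getD 0 0).toNat
  scale := 2 + ∑ j ∈ Finset.range l.length, l.getD j 0 * l.getD j 0
  coeffNum j := l.getD (1 + 2 * j) 0
  coeffDen j := l.getD (2 + 2 * j) 0
  initNum j := l.getD (1 + 2 * (l.getD 0 0).toNat + 2 * j) 0
  initDen j := l.getD (2 + 2 * (l.getD 0 0).toNat + 2 * j) 0

/-- An integer is at most its square in modulus, so the sum of all squares dominates each entry.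
This bound needs no comparisons and has linear bit length. -/
theorem abs_getD_lt_scale (l : List ℤ) (j : ℕ) : |l.getD j 0| < (ofList l).scale := by
  have hnn : ∀ j ∈ Finset.range l.length, 0 ≤ l.getD j 0 * l.getD j 0 :=
    fun j _ => mul_self_nonneg _
  rcases lt_or_ge j l.length with hj | hj
  · have := Finset.single_le_sum hnn (Finset.mem_range.2 hj)
    simp only [ofList]
    have h2 : |l.getD j 0| ≤ l.getD j 0 * l.getD j 0 := by
      rw [← abs_mul_abs_self]
      rcases (abs_nonneg (l.getD j 0)).eq_or_lt with h | h
      · rw [← h]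
        norm_num
      · nlinarith
    linarith
  · rw [List.getD_eq_default _ _ hj]
    have := Finset.sum_nonneg hnn
    simp only [ofList, abs_zero]
    linarith

variable {D : ScaledLRS}

theorem Valid.entryDen_pos (hD : D.Valid) {s t : ℕ} (a : ℕ) (hs : s < 3 + D.order + D.order)
    (ht : t < 3 + D.order + D.order) : 0 < D.entryDen s a t := by
  have hZ := one_pos.trans hD.one_lt_scale
  have hk : (0 : ℤ) < D.order := by exact_mod_cast hD.order_pos
  unfold entryDen rowDen
  split_ifs with h1 h2 h3 h4 h5 h6 h7 <;> try norm_num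
  · have := hD.initDen_pos _ (Valid.component_lt (by omega : 3 ≤ s) hs)
    positivity
  · have := hD.companionDen_pos (D.component s) (Valid.component_lt (by omega : 3 ≤ t) ht)
    positivity

theorem Valid.entry_le_one (hD : D.Valid) {z s a t : ℕ} (hz : z < 2) (ha : a < 2)
    (hs : s < 3 + D.order + D.order) (ht : t < 3 + D.order + D.order) : D.entry z s a t ≤ 1 := by
  have h1 := Finset.single_le_sum (f := fun t => D.entry z s a t)
    (fun t h => hD.entry_nonneg z s a hs (Finset.mem_range.1 h)) (Finset.mem_range.2 ht)
  rw [hD.sum_entry hz ha hs] at h1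
  refine h1.trans ?_
  split_ifs <;> norm_num

/-- Probabilities lie between 0 and 1, so numerator and denominator meet the assumptions of Euclid's
algorithm when it is started with the denominator first. -/
theorem Valid.exists_natCast (hD : D.Valid) {z s a t : ℕ} (hz : z < 2) (ha : a < 2)
    (hs : s < 3 + D.order + D.order) (ht : t < 3 + D.order + D.order) :
    ∃ n d : ℕ, 0 < d ∧ n ≤ d ∧ D.entryNum z s a t = n ∧ D.entryDen s a t = d := by
  have hd := hD.entryDen_pos a hs ht
  have hd' : (0 : ℚ) < D.entryDen s a t := by exact_mod_cast hd
  have h0 := hD.entry_nonneg z s a hs ht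
  have h1 := hD.entry_le_one hz ha hs ht
  rw [entry] at h0 h1
  rw [div_le_one hd'] at h1
  have h0 : (0 : ℚ) ≤ D.entryNum z s a t := by
    rw [← div_mul_cancel₀ (D.entryNum z s a t : ℚ) hd'.ne']
    positivity
  have h0 : 0 ≤ D.entryNum z s a t := by exact_mod_cast h0
  have h1 : D.entryNum z s a t ≤ D.entryDen s a t := by exact_mod_cast h1
  exact ⟨_, _, by omega, by omega, (Int.toNat_of_nonneg h0).symm, (Int.toNat_of_nonneg hd.le).symm⟩

end ScaledLRS

/-! ### The program for a single transition probability -/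

namespace LogRAM

open Prog ScaledLRS
open LogRAM.Expr (eval)

theorem initState_mem_natCast (l : List ℤ) (i : ℕ) :
    (initState l).mem 0 i = l.getD i 0 := by
  simp [initState]

/-- Computes the component and the sign of the state in the register `x`. -/
def componentProg (x i g : ℕ) : Prog :=
  .ifPos (.sub (.add (.const 3) (.var 3)) (.var x))
    (.seq (.assign i (.sub (.var x) (.const 3))) (.assign g (.const 1)))
    (.seq (.assign i (.sub (.sub (.var x) (.const 3)) (.var 3))) (.assign g (.const (-1))))

/-- Computes an entry of the companion matrix. -/
def companionProg : Prog :=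
  .ifPos (.sub (.var 3) (.add (.var 13) (.const 1)))
    (.seq (.ifPos (.sub (.const 1) (.mul (.sub (.var 14) (.add (.var 13) (.const 1)))
        (.sub (.var 14) (.add (.var 13) (.const 1))))) (.assign 17 (.const 1)) (.assign 17 (.const 0)))
      (.assign 18 (.const 1)))
    (.seq (.assign 17 (.get 0 (.add (.const 1) (.mul (.const 2) (.var 14)))))
      (.assign 18 (.get 0 (.add (.const 2) (.mul (.const 2) (.var 14))))))

/-- Assigns a fraction to the registers `8` and `9`. -/
def fraction (n d : Expr) : Prog := .seq (.assign 8 n) (.assign 9 d)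

/-- Computes the probability to move from a component state to a state that is no component. -/
def exitProg : Prog :=
  fraction
    (.add (.mul (.var 2) (.get 0 (.add (.add (.const 2) (.mul (.const 2) (.var 3)))
        (.mul (.const 2) (.var 13)))))
      (.mul (.mul (.var 15) (.sub (.const 3) (.mul (.const 2) (.var 7))))
        (.get 0 (.add (.add (.const 1) (.mul (.const 2) (.var 3))) (.mul (.const 2) (.var 13))))))
    (.mul (.mul (.const 4) (.var 2)) (.get 0 (.add (.add (.const 2)
      (.mul (.const 2) (.var 3))) (.mul (.const 2) (.var 13)))))

/-- Computes the probability to move between component states. -/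
def moveProg : Prog :=
  .seq (componentProg 7 14 16) (.seq companionProg
    (fraction (.add (.mul (.var 2) (.var 18)) (.mul (.mul (.var 15) (.var 16)) (.var 17)))
      (.mul (.mul (.mul (.const 4) (.var 3)) (.var 2)) (.var 18))))

/-- Computes the probability to move from a component state. -/
def rowProg : Prog :=
  .ifPos (.var 7)
    (.seq (componentProg 5 13 15) (.ifPos (.sub (.const 3) (.var 7)) exitProg moveProg))
    (fraction (.const 0) (.const 1))

/-- Runs `c` if the values of `e` and `e'` are equal and `d` otherwise. -/
def ifEq (e e' : Expr) (c d : Prog) : Prog :=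
  .ifPos (.sub (.const 1) (.mul (.sub e e') (.sub e e'))) c d

/-- Computes the probability of a transition of the counter. -/
def counterProg (z : ℕ) : Prog :=
  .ifPos (.var 7)
    (.ifPos (.var 6)
      (ifEq (.var 7) (.add (.const 3) (.mul (.const z) (.var 3)))
        (fraction (.const 1) (.const 2)) (fraction (.const 0) (.const 2)))
      (ifEq (.var 7) (.const 3) (fraction (.const 1) (.const 4))
        (ifEq (.var 7) (.add (.const 3) (.var 3)) (fraction (.const 1) (.const 4))
          (fraction (.const 0) (.const 4)))))
    (fraction (.const 1) (.const 2))

/-- Computes a transition probability. -/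
def entryProg (z : ℕ) : Prog :=
  .ifPos (.var 5)
    (.ifPos (.var 6) (fraction (.const 0) (.const 1))
      (.ifPos (.sub (.var 5) (.const 2)) rowProg
        (.ifPos (.sub (.var 5) (.const 1))
          (ifEq (.var 7) (.const 1) (fraction (.const 1) (.const 1))
            (fraction (.const 0) (.const 1)))
          (fraction (.const 0) (.const 1)))))
    (counterProg z)

/-- The registers that hold intermediate results. -/
def isTemporary (x : ℕ) : Bool := 8 ≤ x && x < 19

/-- This guarantees that the loop counters, the input array and the output survive the computation
of an entry. -/
theorem entryProg_assignsOnly (z : ℕ) : (entryProg z).AssignsOnly isTemporary = true := by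
  simp [entryProg, counterProg, rowProg, exitProg, moveProg, componentProg, companionProg, fraction, ifEq,
    AssignsOnly, isTemporary]

/-- The machine only tests for positivity. Over the integers this expression turns a test for
equality into one. -/
theorem one_sub_mul_self_pos_iff (x y : ℤ) : 0 < 1 - (x - y) * (x - y) ↔ x = y := by
  constructor
  · intro h
    by_contra hne
    have : x - y ≠ 0 := sub_ne_zero.2 hne
    have := mul_self_pos.2 this
    omega
  · rintro rfl
    simp

theorem exec_ifEq (e e' : Expr) (c d : Prog) (σ : State) :
    (ifEq e e' c d).exec σ = if e.eval σ = e'.eval σ then c.exec σ else d.exec σ := by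
  simp only [ifEq, exec, eval, one_sub_mul_self_pos_iff]

theorem exec_componentProg {D : ScaledLRS} {x i g s : ℕ} {σ : State}
    (hσ : σ.reg 3 = D.order) (hx : σ.reg x = s) (hs : 3 ≤ s) :
    ((componentProg x i g).exec σ).reg =
      Function.update (Function.update σ.reg i (D.component s)) g (D.sign s) := by
  simp only [componentProg, exec, eval, hσ, hx, component, sign]
  by_cases h : s < 3 + D.order
  · have h' : (0 : ℤ) < 3 + D.order - s := by omega
    have e : (s : ℤ) - 3 = (s - 3 : ℕ) := by omega
    rw [if_pos h', if_pos h, if_pos h, e]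
  · have h' : ¬ (0 : ℤ) < 3 + D.order - s := by omega
    have e : (s : ℤ) - 3 - D.order = (s - 3 - D.order : ℕ) := by omega
    rw [if_neg h', if_neg h, if_neg h, e]

section Entry

variable {l : List ℤ} {z s a t i j : ℕ} {σ : State}

theorem exec_companionProg (h3 : σ.reg 3 = (ofList l).order) (h13 : σ.reg 13 = i)
    (h14 : σ.reg 14 = j) (hm : σ.mem = (initState l).mem) :
    (companionProg.exec σ).reg =
      Function.update (Function.update σ.reg 17 ((ofList l).companionNum i j)) 18
        ((ofList l).companionDen i j) := by
  have e1 : (1 : ℤ) + 2 * j = ((1 + 2 * j : ℕ) : ℤ) := by push_cast; rfl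
  have e2 : (2 : ℤ) + 2 * j = ((2 + 2 * j : ℕ) : ℤ) := by push_cast; rfl
  have i1 : (ofList l).coeffNum j = l.getD (1 + 2 * j) 0 := rfl
  have i2 : (ofList l).coeffDen j = l.getD (2 + 2 * j) 0 := rfl
  have hij : (j : ℤ) = i + 1 ↔ j = i + 1 := by omega
  simp only [companionProg, exec, eval, h3, h13, h14, companionNum, companionDen,
    one_sub_mul_self_pos_iff, hij]
  by_cases h : i + 1 < (ofList l).order
  · have h' : (0 : ℤ) < (ofList l).order - (i + 1) := by omega
    simp only [h, h', if_true]
    split_ifs <;> rfl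
  · have h' : ¬ (0 : ℤ) < (ofList l).order - (i + 1) := by omega
    simp only [h, h', if_false, hm, e1, e2, initState_mem_natCast, i1, i2, ne_eq,
      Nat.reduceEqDiff, not_false_eq_true, Function.update_of_ne, h14]

theorem exec_exitProg (h2 : σ.reg 2 = (ofList l).scale) (h3 : σ.reg 3 = (ofList l).order)
    (h7 : σ.reg 7 = t) (h13 : σ.reg 13 = (ofList l).component s)
    (h15 : σ.reg 15 = (ofList l).sign s) (hm : σ.mem = (initState l).mem) (ht : t ≠ 0)
    (ht3 : t < 3) : (exitProg.exec σ).reg 8 = (ofList l).rowNum s t ∧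
      (exitProg.exec σ).reg 9 = (ofList l).rowDen s t := by
  have hk : (ofList l).order = (l.getD 0 0).toNat := rfl
  have e1 : (1 : ℤ) + 2 * (ofList l).order + 2 * (ofList l).component s =
      ((1 + 2 * (l.getD 0 0).toNat + 2 * (ofList l).component s : ℕ) : ℤ) := by
    rw [hk]
    push_cast
    rfl
  have e2 : (2 : ℤ) + 2 * (ofList l).order + 2 * (ofList l).component s =
      ((2 + 2 * (l.getD 0 0).toNat + 2 * (ofList l).component s : ℕ) : ℤ) := by
    rw [hk]
    push_cast
    rfl
  have i1 : (ofList l).initNum ((ofList l).component s) =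
    l.getD (1 + 2 * (l.getD 0 0).toNat + 2 * (ofList l).component s) 0 := rfl
  have i2 : (ofList l).initDen ((ofList l).component s) =
    l.getD (2 + 2 * (l.getD 0 0).toNat + 2 * (ofList l).component s) 0 := rfl
  simp only [exitProg, fraction, exec, eval, rowNum, rowDen, ht, ht3, if_true, if_false,
    Function.update_self, ne_eq, Nat.reduceEqDiff, not_false_eq_true, Function.update_of_ne,
    h2, h3, h7, h13, h15, hm, e1, e2, initState_mem_natCast, i1, i2, and_self]

theorem exec_moveProg (h2 : σ.reg 2 = (ofList l).scale) (h3 : σ.reg 3 = (ofList l).order)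
    (h7 : σ.reg 7 = t) (h13 : σ.reg 13 = (ofList l).component s)
    (h15 : σ.reg 15 = (ofList l).sign s) (hm : σ.mem = (initState l).mem) (ht3 : 3 ≤ t) :
    (moveProg.exec σ).reg 8 = (ofList l).rowNum s t ∧
      (moveProg.exec σ).reg 9 = (ofList l).rowDen s t := by
  have hc : ((componentProg 7 14 16).exec σ).reg = _ :=
    exec_componentProg h3 h7 ht3
  have hcm : ((componentProg 7 14 16).exec σ).mem = σ.mem :=
    AssignsOnly.exec_mem (p := isTemporary) rfl σ
  have hd := exec_companionProg (i := (ofList l).component s) (j := (ofList l).component t)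
    (σ := (componentProg 7 14 16).exec σ) (l := l) (by simp [hc, h3]) (by simp [hc, h13])
    (by simp [hc]) (hcm.trans hm)
  have ht0 : t ≠ 0 := by omega
  have ht3' : ¬ t < 3 := by omega
  simp [moveProg, fraction, exec, eval, rowNum, rowDen, ht0, ht3', hd, hc, h2, h3, h15]

theorem exec_rowProg (h2 : σ.reg 2 = (ofList l).scale) (h3 : σ.reg 3 = (ofList l).order)
    (h5 : σ.reg 5 = s) (h7 : σ.reg 7 = t) (hm : σ.mem = (initState l).mem) (hs : 3 ≤ s) :
    (rowProg.exec σ).reg 8 = (ofList l).rowNum s t ∧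
      (rowProg.exec σ).reg 9 = (ofList l).rowDen s t := by
  by_cases ht : t = 0
  · simp [rowProg, exec, eval, fraction, h7, ht, rowNum, rowDen]
  have ht' : (0 : ℤ) < t := by omega
  have hc : ((componentProg 5 13 15).exec σ).reg = _ :=
    exec_componentProg h3 h5 hs
  have hcm : ((componentProg 5 13 15).exec σ).mem = σ.mem :=
    AssignsOnly.exec_mem (p := isTemporary) rfl σ
  have hc2 : ((componentProg 5 13 15).exec σ).reg 2 = (ofList l).scale := by simp [hc, h2]
  have hc3 : ((componentProg 5 13 15).exec σ).reg 3 = (ofList l).order := by simp [hc, h3]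
  have hc7 : ((componentProg 5 13 15).exec σ).reg 7 = t := by simp [hc, h7]
  have hc13 : ((componentProg 5 13 15).exec σ).reg 13 = (ofList l).component s := by simp [hc]
  have hc15 : ((componentProg 5 13 15).exec σ).reg 15 = (ofList l).sign s := by simp [hc]
  simp only [rowProg, exec, eval, h7, ht', if_true, hc7]
  by_cases ht3 : t < 3
  · rw [if_pos (by omega)]
    exact exec_exitProg hc2 hc3 hc7 hc13 hc15 (hcm.trans hm) ht ht3
  · rw [if_neg (by omega)]
    exact exec_moveProg hc2 hc3 hc7 hc13 hc15 (hcm.trans hm) (by omega)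

theorem exec_counterProg (h3 : σ.reg 3 = (ofList l).order) (h6 : σ.reg 6 = a) (h7 : σ.reg 7 = t) :
    ((counterProg z).exec σ).reg 8 = (ofList l).entryNum z 0 a t ∧
      ((counterProg z).exec σ).reg 9 = (ofList l).entryDen 0 a t := by
  have e1 : (t : ℤ) = 3 + z * (ofList l).order ↔ t = 3 + z * (ofList l).order := by
    rw [← Nat.cast_inj (R := ℤ)]
    push_cast
    rfl
  have e2 : (t : ℤ) = 3 ↔ t = 3 := by omega
  have e3 : (t : ℤ) = 3 + (ofList l).order ↔ t = 3 + (ofList l).order := by omega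
  have e4 : (0 : ℤ) < t ↔ ¬ t = 0 := by omega
  have e5 : (0 : ℤ) < a ↔ ¬ a = 0 := by omega
  simp only [counterProg, fraction, exec, exec_ifEq, eval, h3, h6, h7, e1, e2, e3, e4, e5, entryNum,
    entryDen, if_true]
  split_ifs <;> simp_all

theorem exec_entryProg (h2 : σ.reg 2 = (ofList l).scale) (h3 : σ.reg 3 = (ofList l).order)
    (h5 : σ.reg 5 = s) (h6 : σ.reg 6 = a) (h7 : σ.reg 7 = t) (hm : σ.mem = (initState l).mem) :
    ((entryProg z).exec σ).reg 8 = (ofList l).entryNum z s a t ∧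
      ((entryProg z).exec σ).reg 9 = (ofList l).entryDen s a t := by
  by_cases hs : s = 0
  · subst hs
    simp only [entryProg, exec, eval, h5, Nat.cast_zero, lt_irrefl, if_false]
    exact exec_counterProg h3 h6 h7
  have e1 : (0 : ℤ) < s := by omega
  have e2 : (0 : ℤ) < a ↔ ¬ a = 0 := by omega
  have e3 : (0 : ℤ) < s - 2 ↔ ¬ s < 3 := by omega
  have e4 : (0 : ℤ) < s - 1 ↔ ¬ s = 1 := by omega
  have e5 : (t : ℤ) = 1 ↔ t = 1 := by omega
  simp only [entryProg, exec, exec_ifEq, eval, h5, h6, h7, e1, e2, e3, e4, e5, if_true, entryNum,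
    entryDen, hs, if_false]
  by_cases ha : a = 0
  · by_cases hs3 : s < 3
    · simp only [ha, hs3, not_true_eq_false, if_true, if_false]
      by_cases h1 : s = 1
      · simp [h1, fraction, exec, eval]
      · have : s = 2 := by omega
        simp only [this, fraction, exec, eval]
        split_ifs <;> simp_all
    · have h1 : s ≠ 1 := by omega
      have h2' : s ≠ 2 := by omega
      simp only [ha, hs3, h1, h2', not_true_eq_false, not_false_eq_true, if_true, if_false]
      exact exec_rowProg h2 h3 h5 h7 hm (by omega)
  · simp [ha, fraction, exec, eval]

end Entry

end LogRAM

/-! ### The program for the whole instance -/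

namespace LogRAM

open Prog ScaledLRS
open LogRAM.Expr (eval)

/-- Computes the bound on the numerators. -/
def scaleProg : Prog :=
  .seq (.assign 2 (.const 2)) (.loopPos (.sub (.var 0) (.var 1))
    (.seq (.assign 2 (.add (.var 2) (.mul (.get 0 (.var 1)) (.get 0 (.var 1)))))
      (.assign 1 (.add (.var 1) (.const 1)))))

/-- Writes the numbers of states and actions and the initial state. -/
def headerProg : Prog :=
  .seq (.assign 3 (.get 0 (.const 0))) (.seq (.assign 4 (.add (.add (.const 3) (.var 3)) (.var 3)))
    (.seq (.emit (.var 4)) (.seq (.emit (.const 2)) (.emit (.const 0)))))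

/-- Prepares the reduction of a fraction to lowest terms. -/
def setupProg : Prog := .seq (.assign 10 (.var 9)) (.assign 11 (.var 8))

/-- Resets the registers `8, …, 7 + n`. -/
def resetProg : ℕ → Prog
  | 0 => .skip
  | n + 1 => .seq (resetProg n) (.assign (8 + n) (.const 0))

/-- Writes a fraction in lowest terms. -/
def finishProg : Prog :=
  .seq (.emit (.div (.var 8) (.var 10))) (.seq (.emit (.div (.var 9) (.var 10)))
    (.seq (resetProg 11) (.assign 7 (.add (.var 7) (.const 1)))))

/-- Writes a transition probability. -/
def targetBody (z : ℕ) : Prog :=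
  .seq (entryProg z) (.seq setupProg (.seq (euclid 10 11 12) finishProg))

/-- Writes the transition probabilities for a state and an action. -/
def targetLoop (z : ℕ) : Prog := .loopPos (.sub (.var 4) (.var 7)) (targetBody z)

def weightProg : Prog := .ifPos (.var 5) (.emit (.const (-1))) (.emit (.const 1))

def nextActionProg : Prog :=
  .seq (.assign 7 (.const 0)) (.assign 6 (.add (.var 6) (.const 1)))

def nextStateProg : Prog :=
  .seq (.assign 6 (.const 0)) (.assign 5 (.add (.var 5) (.const 1)))

def actionBody (z : ℕ) : Prog := .seq weightProg (.seq (targetLoop z) nextActionProg)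

def actionLoop (z : ℕ) : Prog := .loopPos (.sub (.const 2) (.var 6)) (actionBody z)

def stateBody (z : ℕ) : Prog := .seq (actionLoop z) nextStateProg

def stateLoop (z : ℕ) : Prog := .loopPos (.sub (.var 4) (.var 5)) (stateBody z)

def thresholdProg : Prog := .seq (.emit (.const 1)) (.emit (.const 2))

/-- The reduction. -/
def reductionProg (z : ℕ) : Prog :=
  .seq scaleProg (.seq headerProg (.seq (stateLoop z) thresholdProg))

/-- The states in which the bound on the numerators is computed. -/
def scaleState (l : List ℤ) (i : ℕ) : State where
  reg
    | 0 => l.length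
    | 1 => i
    | 2 => 2 + ∑ j ∈ Finset.range i, l.getD j 0 * l.getD j 0
    | _ => 0
  mem := (initState l).mem
  out := []

/-- The states in which the output is written. -/
def outState (l : List ℤ) (s a t : ℕ) (out : List ℤ) : State where
  reg
    | 0 => l.length
    | 1 => l.length
    | 2 => (ofList l).scale
    | 3 => (ofList l).order
    | 4 => (3 + (ofList l).order + (ofList l).order : ℕ)
    | 5 => s
    | 6 => a
    | 7 => t
    | _ => 0
  mem := (initState l).mem
  out := out

theorem State.ext' {σ τ : State} (h1 : σ.reg = τ.reg) (h2 : σ.mem = τ.mem) (h3 : σ.out = τ.out) :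
    σ = τ := by
  cases σ
  cases τ
  simp_all

theorem bitLength_getD_le (l : List ℤ) (i : ℕ) : bitLength (l.getD i 0) ≤ listSize l + 1 := by
  rcases lt_or_ge i l.length with h | h
  · have : bitLength (l.getD i 0) ≤ listSize l := by
      rw [List.getD_eq_getElem _ _ h]
      exact List.single_le_sum (by simp) _ (List.mem_map_of_mem (List.getElem_mem h))
    omega
  · rw [List.getD_eq_default _ _ h]
    simp [bitLength]

theorem length_le_listSize (l : List ℤ) : l.length ≤ listSize l := by
  induction l with
  | nil => simp
  | cons x l ih =>
    have := one_le_bitLength x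
    simp only [listSize, List.map_cons, List.sum_cons, List.length_cons] at *
    omega

theorem bitLength_mem_le (l : List ℤ) (a : ℕ) (i : ℤ) :
    bitLength ((initState l).mem a i) ≤ listSize l + 1 := by
  simp only [initState]
  split_ifs
  · exact bitLength_getD_le l _
  · simp [bitLength]

/-- Each entry contributes at most twice its own length, which is the length of its square. -/
theorem bitLength_scale_le (l : List ℤ) {i : ℕ} (hi : i ≤ l.length) :
    bitLength (2 + ∑ j ∈ Finset.range i, l.getD j 0 * l.getD j 0) ≤
      3 + 2 * listSize (l.take i) := by
  induction i with
  | zero => simp [bitLength, listSize]; decide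
  | succ i ih =>
    have hlt : i < l.length := hi
    rw [Finset.sum_range_succ, ← add_assoc]
    have h1 := ih hlt.le
    have h2 : listSize (l.take (i + 1)) = listSize (l.take i) + bitLength (l.getD i 0) := by
      rw [List.take_add_one, List.getD_eq_getElem _ _ hlt, List.getElem?_eq_getElem hlt]
      simp only [listSize, List.map_append, List.sum_append, Option.toList_some, List.map_cons,
        List.map_nil, List.sum_cons, List.sum_nil, add_zero]
    have h3 := bitLength_add_le (2 + ∑ j ∈ Finset.range i, l.getD j 0 * l.getD j 0)
      (l.getD i 0 * l.getD i 0)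
    have h4 := bitLength_mul_le (l.getD i 0) (l.getD i 0)
    omega

theorem listSize_take_le (l : List ℤ) (i : ℕ) : listSize (l.take i) ≤ listSize l := by
  conv_rhs => rw [← List.take_append_drop i l]
  simp only [listSize, List.map_append, List.sum_append, Nat.le_add_right]

/-- A bound on the values that occur as long as no transition probability is computed. -/
def valueBound (l : List ℤ) : ℕ := 2 * listSize l + 6

theorem bd_scaleState (l : List ℤ) {i : ℕ} (hi : i ≤ l.length) :
    Bd (scaleState l i) (valueBound l) := by
  have hl := length_le_listSize l
  constructor
  · intro x
    unfold scaleState valueBound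
    dsimp only
    split
    · exact (bitLength_natCast_le _).trans (by omega)
    · exact (bitLength_natCast_le _).trans (by omega)
    · have := bitLength_scale_le l hi
      have := listSize_take_le l i
      omega
    · simp [bitLength]
  · intro a i
    exact (bitLength_mem_le l a i).trans (by unfold valueBound; omega)

theorem outState_reg_eq (l : List ℤ) {s a t s' a' t' : ℕ} (out out' : List ℤ) {x : ℕ}
    (h5 : x = 5 → s = s') (h6 : x = 6 → a = a') (h7 : x = 7 → t = t') :
    (outState l s a t out).reg x = (outState l s' a' t' out').reg x := by
  rcases x with _ | _ | _ | _ | _ | _ | _ | _ | x <;> simp_all [outState]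

theorem bd_outState {l : List ℤ} (hk : 2 * (ofList l).order ≤ l.length) {s a t : ℕ}
    (hs : s ≤ 3 + (ofList l).order + (ofList l).order) (ha : a ≤ 2)
    (ht : t ≤ 3 + (ofList l).order + (ofList l).order) (out : List ℤ) :
    Bd (outState l s a t out) (valueBound l) := by
  have hl := length_le_listSize l
  constructor
  · intro x
    unfold outState valueBound
    dsimp only
    split
    · exact (bitLength_natCast_le _).trans (by omega)
    · exact (bitLength_natCast_le _).trans (by omega)
    · have := bitLength_scale_le l le_rfl
      have := listSize_take_le l l.length
      simp only [ofList]
      omega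
    · exact (bitLength_natCast_le _).trans (by omega)
    · exact (bitLength_natCast_le _).trans (by omega)
    · exact (bitLength_natCast_le _).trans (by omega)
    · exact (bitLength_natCast_le _).trans (by omega)
    · exact (bitLength_natCast_le _).trans (by omega)
    · simp [bitLength]
  · intro a i
    exact (bitLength_mem_le l a i).trans (by unfold valueBound; omega)

theorem reaches_scaleProg (l : List ℤ) : Reaches scaleProg (initState l) (scaleState l l.length)
    (bitLength 2 + 1 + (l.length + 1) * ((Expr.sub (.var 0) (.var 1)).size ^ 2 * valueBound l + 1 +
      (Prog.seq (.assign 2 (.add (.var 2) (.mul (.get 0 (.var 1)) (.get 0 (.var 1)))))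
        (.assign 1 (.add (.var 1) (.const 1)))).weight * valueBound l)) := by
  refine Reaches.seq (τ := scaleState l 0) ⟨_, ?_, le_rfl⟩ ?_
  · have h : scaleState l 0 =
        { initState l with reg := Function.update (initState l).reg 2 2 } := by
      refine State.ext' (funext fun x => ?_) rfl rfl
      simp only [scaleState, initState, Function.update_apply]
      split <;> simp_all
    rw [h]
    exact Run.assign _ _ _
  · refine Reaches.loop (scaleState l) (fun i hi => bd_scaleState l hi) (fun i hi => ?_) ?_
      (fun i hi => ?_)
    · simpa [eval, scaleState] using hi
    · simp [eval, scaleState]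
    · refine Prog.LoopFree.reaches (by simp [LoopFree]) (bd_scaleState l hi.le) ?_
      refine State.ext' (funext fun x => ?_) rfl rfl
      have hm : (scaleState l i).mem 0 i = l.getD i 0 := initState_mem_natCast l i
      have h1 : (scaleState l i).reg 1 = i := rfl
      have h2 : (scaleState l i).reg 2 = 2 + ∑ j ∈ Finset.range i, l.getD j 0 * l.getD j 0 := rfl
      have h3 : 2 + ∑ j ∈ Finset.range (i + 1), l.getD j 0 * l.getD j 0 =
          (2 + ∑ j ∈ Finset.range i, l.getD j 0 * l.getD j 0) + l.getD i 0 * l.getD i 0 := by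
        rw [Finset.sum_range_succ, add_assoc]
      simp only [exec, eval, h1, h2, hm]
      rcases x with _ | _ | _ | x
      · rfl
      · simp [scaleState]
      · exact h3.symm
      · rfl

theorem reaches_headerProg {l : List ℤ} (h0 : l.getD 0 0 = (ofList l).order) :
    Reaches headerProg (scaleState l l.length)
      (outState l 0 0 0 [((3 + (ofList l).order + (ofList l).order : ℕ) : ℤ), 2, 0])
      (headerProg.weight * valueBound l) := by
  refine Prog.LoopFree.reaches (by simp [headerProg, LoopFree]) (bd_scaleState l le_rfl) ?_
  have hm : (scaleState l l.length).mem 0 0 = (ofList l).order :=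
    (initState_mem_natCast l 0).trans h0
  refine State.ext' (funext fun x => ?_) rfl ?_
  · simp only [headerProg, exec, eval, hm]
    rcases x with _ | _ | _ | _ | _ | _ | _ | _ | x <;>
      try simp [outState, scaleState]
    rfl
  · have hm' : (initState l).mem 0 0 = (ofList l).order := hm
    simp [headerProg, exec, eval, hm', outState, scaleState]

theorem resetProg_loopFree (n : ℕ) : (resetProg n).LoopFree := by
  induction n with
  | zero => trivial
  | succ n ih => exact ⟨ih, trivial⟩

theorem exec_resetProg (n : ℕ) (σ : State) : (resetProg n).exec σ =
    { σ with reg := fun x => if 8 ≤ x ∧ x < 8 + n then 0 else σ.reg x } := by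
  induction n with
  | zero =>
    refine State.ext' (funext fun x => ?_) rfl rfl
    dsimp only [resetProg, exec]
    rw [if_neg (by omega)]
  | succ n ih =>
    simp only [resetProg, exec, ih, eval]
    congr 1
    funext x
    simp only [Function.update_apply]
    split_ifs <;> first | rfl | omega

/-- Clearing the temporary registers brings the machine back to a state of the form `outState`. The
lengths of all values are then again bounded by `valueBound`, so growth does not accumulate over the
loops. -/
theorem exec_finishProg (σ : State) : finishProg.exec σ =
    { σ with
      reg := fun x => if x = 7 then σ.reg 7 + 1 else if 8 ≤ x ∧ x < 19 then 0 else σ.reg x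
      out := σ.out ++ [σ.reg 8 / σ.reg 10, σ.reg 9 / σ.reg 10] } := by
  simp only [finishProg, exec, eval, exec_resetProg]
  refine State.ext' (funext fun x => ?_) rfl (by simp)
  simp [Function.update_apply]

/-- The cost of writing a transition probability. -/
def targetCost (z B : ℕ) : ℕ :=
  (entryProg z).weight * B + (setupProg.weight * ((entryProg z).growth * B) +
    ((2 * (setupProg.growth * ((entryProg z).growth * B)) + 1) *
      (23 * (setupProg.growth * ((entryProg z).growth * B))) +
      finishProg.weight * (setupProg.growth * ((entryProg z).growth * B))))

/-- The cost of writing the transition probabilities for a state and an action. -/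
def actionCost (z B : ℕ) : ℕ :=
  weightProg.weight * B + ((B + 1) * ((Expr.sub (.var 4) (.var 7)).size ^ 2 * B + 1 +
    targetCost z B) + nextActionProg.weight * B)

/-- The cost of writing the data of a state. -/
def stateCost (z B : ℕ) : ℕ :=
  (2 + 1) * ((Expr.sub (.const 2) (.var 6)).size ^ 2 * B + 1 + actionCost z B) +
    nextStateProg.weight * B

theorem flatMap_range_succ {α : Type*} (f : ℕ → List α) (n : ℕ) :
    (List.range (n + 1)).flatMap f = (List.range n).flatMap f ++ f n := by
  simp [List.range_succ]

section Loops

variable {l : List ℤ} (hD : (ofList l).Valid) (hk : 2 * (ofList l).order ≤ l.length) {z : ℕ}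
  (hz : z < 2)
include hD hk hz

theorem reaches_targetBody {s a t : ℕ} (hs : s < 3 + (ofList l).order + (ofList l).order)
    (ha : a < 2) (ht : t < 3 + (ofList l).order + (ofList l).order) (out : List ℤ) :
    Reaches (targetBody z) (outState l s a t out)
      (outState l s a (t + 1) (out ++ encodeRat ((ofList l).entry z s a t)))
      (targetCost z (valueBound l)) := by
  have hB := bd_outState hk hs.le ha.le ht.le out
  have honly := entryProg_assignsOnly z
  have hframe := fun x hx => AssignsOnly.exec_reg honly (outState l s a t out) (x := x) hx
  obtain ⟨t₁, r₁, c₁, b₁⟩ := (AssignsOnly.loopFree honly).run hB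
  obtain ⟨e₈, e₉⟩ := exec_entryProg (z := z) (l := l) (s := s) (a := a) (t := t)
    (σ := outState l s a t out) rfl rfl rfl rfl rfl rfl
  have hmem := AssignsOnly.exec_mem honly (outState l s a t out)
  have hout := AssignsOnly.exec_out honly (outState l s a t out)
  obtain ⟨n, d, hd, hnd, hn', hd'⟩ := hD.exists_natCast hz ha hs ht
  rw [hn'] at e₈
  rw [hd'] at e₉
  set σ₁ := (entryProg z).exec (outState l s a t out) with hσ₁
  obtain ⟨t₂, r₂, c₂, b₂⟩ := LoopFree.run (c := setupProg) (by simp [setupProg, LoopFree]) b₁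
  set σ₂ := setupProg.exec σ₁ with hσ₂
  set B₂ := setupProg.growth * ((entryProg z).growth * valueBound l) with hB₂
  have hr₂ : σ₂.reg = Function.update (Function.update σ₁.reg 10 d) 11 n := by
    simp [hσ₂, setupProg, exec, eval, e₈, e₉]
  have h10 : σ₂.reg 10 = d := by simp [hr₂]
  have h11 : σ₂.reg 11 = n := by simp [hr₂]
  -- Both numbers are shorter than `B₂` bits, up to the sign bit, so Euclid's algorithm takes at
  -- most `2 * B₂` rounds.
  have hlt : d * n < 2 ^ (2 * B₂) := by
    have hdB : d < 2 ^ B₂ := by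
      have := b₂.reg 10
      rw [h10] at this
      simpa using bitLength_le_iff.1 (this.trans (Nat.le_succ _))
    rw [two_mul, pow_add]
    exact Nat.mul_lt_mul'' hdB (hnd.trans_lt hdB)
  obtain ⟨τ, ⟨t₃, r₃, c₃⟩, b₃, hgcd, hτm, hτo, hτr⟩ :=
    euclid_reaches (x := 10) (y := 11) (z := 12) (by norm_num) (by norm_num) (by norm_num) (2 * B₂)
      hnd hlt b₂ h10 h11
  refine Reaches.seq ⟨t₁, r₁, c₁⟩ (Reaches.seq ⟨t₂, r₂, c₂⟩ (Reaches.seq ⟨t₃, r₃, c₃⟩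
    (Prog.LoopFree.reaches ?_ b₃ ?_)))
  · exact ⟨trivial, trivial, resetProg_loopFree 11, trivial⟩
  · have hτ : ∀ x, isTemporary x = false → τ.reg x = (outState l s a t out).reg x := by
      intro x hx
      have h1 : x ≠ 10 := by rintro rfl; simp [isTemporary] at hx
      have h2 : x ≠ 11 := by rintro rfl; simp [isTemporary] at hx
      have h3 : x ≠ 12 := by rintro rfl; simp [isTemporary] at hx
      rw [hτr x h1 h2 h3, hr₂, Function.update_of_ne h2, Function.update_of_ne h1, hframe x hx]
    have h8 : τ.reg 8 = n := by
      rw [hτr 8 (by norm_num) (by norm_num) (by norm_num), hr₂]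
      simp [e₈]
    have h9 : τ.reg 9 = d := by
      rw [hτr 9 (by norm_num) (by norm_num) (by norm_num), hr₂]
      simp [e₉]
    rw [exec_finishProg]
    refine State.ext' (funext fun x => ?_) ?_ ?_
    · simp only
      split_ifs with h1 h2
      · subst h1
        rw [hτ 7 rfl]
        simp [outState]
      · rcases x with _ | _ | _ | _ | _ | _ | _ | _ | x <;> first | omega | rfl
      · rw [hτ x (by simp only [isTemporary, Bool.and_eq_false_iff, decide_eq_false_iff_not]; omega)]
        exact outState_reg_eq l _ _ (fun _ => rfl) (fun _ => rfl) (fun h => absurd h h1)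
    · exact hτm.trans hmem
    · have ho : τ.out = out := hτo.trans hout
      simp only [ho, h8, h9, hgcd, outState, entry, hn', hd']
      congr 1
      simpa using (encodeRat_div (n := n) hd).symm

/-- The output for a state and an action. -/
def actionOut (D : ScaledLRS) (z s a : ℕ) : List ℤ :=
  (if s = 0 then 1 else -1) :: (List.range (3 + D.order + D.order)).flatMap fun t =>
    encodeRat (D.entry z s a t)

theorem reaches_targetLoop {s a : ℕ} (hs : s < 3 + (ofList l).order + (ofList l).order)
    (ha : a < 2) (out : List ℤ) :
    Reaches (targetLoop z) (outState l s a 0 out)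
      (outState l s a (3 + (ofList l).order + (ofList l).order) (out ++
        (List.range (3 + (ofList l).order + (ofList l).order)).flatMap fun t =>
          encodeRat ((ofList l).entry z s a t)))
      ((valueBound l + 1) * ((Expr.sub (.var 4) (.var 7)).size ^ 2 * valueBound l + 1 +
        targetCost z (valueBound l))) := by
  have := Reaches.loop (e := .sub (.var 4) (.var 7)) (c := targetBody z)
    (fun t => outState l s a t (out ++ (List.range t).flatMap fun t =>
      encodeRat ((ofList l).entry z s a t))) (n := 3 + (ofList l).order + (ofList l).order)
    (T := targetCost z (valueBound l)) (B := valueBound l)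
    (fun t ht => bd_outState hk hs.le ha.le ht _) (fun t ht => ?_) ?_ (fun t ht => ?_)
  · simp only [List.range_zero, List.flatMap_nil, List.append_nil] at this
    -- The number of rounds is the number of states, which is at most `valueBound l` because the
    -- input has at least `2 * order` entries.
    refine this.mono (Nat.mul_le_mul_right _ ?_)
    have := length_le_listSize l
    unfold valueBound
    omega
  · simp only [eval, outState]
    omega
  · simp [eval, outState]
  · rw [flatMap_range_succ _ t, ← List.append_assoc]
    exact reaches_targetBody hD hk hz hs ha ht _

theorem reaches_actionBody {s a : ℕ} (hs : s < 3 + (ofList l).order + (ofList l).order)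
    (ha : a < 2) (out : List ℤ) :
    Reaches (actionBody z) (outState l s a 0 out)
      (outState l s (a + 1) 0 (out ++ actionOut (ofList l) z s a))
      (actionCost z (valueBound l)) := by
  refine Reaches.seq (τ := outState l s a 0 (out ++ [if s = 0 then 1 else -1]))
    (Prog.LoopFree.reaches (by simp [weightProg, LoopFree])
      (bd_outState hk hs.le ha.le (Nat.zero_le _) out) ?_)
    (Reaches.seq (reaches_targetLoop hD hk hz hs ha _) (Prog.LoopFree.reaches
      (by simp [nextActionProg, LoopFree]) (bd_outState hk hs.le ha.le le_rfl _) ?_))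
  · have h5 : (outState l s a 0 out).reg 5 = s := rfl
    simp only [weightProg, exec, eval, h5]
    by_cases h : s = 0
    · simp [h, outState]
    · rw [if_pos (by omega), if_neg h]
      rfl
  · refine State.ext' (funext fun x => ?_) rfl ?_
    · rcases x with _ | _ | _ | _ | _ | _ | _ | _ | x <;>
        simp [nextActionProg, exec, eval, outState]
    · simp [nextActionProg, exec, outState, actionOut]

theorem reaches_stateBody {s : ℕ} (hs : s < 3 + (ofList l).order + (ofList l).order)
    (out : List ℤ) :
    Reaches (stateBody z) (outState l s 0 0 out)
      (outState l (s + 1) 0 0 (out ++ (List.range 2).flatMap fun a => actionOut (ofList l) z s a))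
      (stateCost z (valueBound l)) := by
  refine Reaches.seq (τ := outState l s 2 0 (out ++ (List.range 2).flatMap fun a =>
    actionOut (ofList l) z s a)) ?_ (Prog.LoopFree.reaches (by simp [nextStateProg, LoopFree])
      (bd_outState hk hs.le le_rfl (Nat.zero_le _) _) ?_)
  · have := Reaches.loop (e := .sub (.const 2) (.var 6)) (c := actionBody z)
      (fun a => outState l s a 0 (out ++ (List.range a).flatMap fun a =>
        actionOut (ofList l) z s a)) (n := 2) (T := actionCost z (valueBound l))
      (B := valueBound l)
      (fun a ha => bd_outState hk hs.le ha (Nat.zero_le _) _) (fun a ha => ?_) ?_ (fun a ha => ?_)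
    · simp only [List.range_zero, List.flatMap_nil, List.append_nil] at this
      exact this
    · simp only [eval, outState]
      omega
    · simp [eval, outState]
    · rw [flatMap_range_succ _ a, ← List.append_assoc]
      exact reaches_actionBody hD hk hz hs ha _
  · refine State.ext' (funext fun x => ?_) rfl rfl
    rcases x with _ | _ | _ | _ | _ | _ | _ | _ | x <;>
      simp [nextStateProg, exec, eval, outState]

theorem reaches_stateLoop (out : List ℤ) :
    Reaches (stateLoop z) (outState l 0 0 0 out)
      (outState l (3 + (ofList l).order + (ofList l).order) 0 0 (out ++
        (List.range (3 + (ofList l).order + (ofList l).order)).flatMap fun s =>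
          (List.range 2).flatMap fun a => actionOut (ofList l) z s a))
      ((valueBound l + 1) * ((Expr.sub (.var 4) (.var 5)).size ^ 2 * valueBound l + 1 +
        stateCost z (valueBound l))) := by
  have := Reaches.loop (e := .sub (.var 4) (.var 5)) (c := stateBody z)
    (fun s => outState l s 0 0 (out ++ (List.range s).flatMap fun s =>
      (List.range 2).flatMap fun a => actionOut (ofList l) z s a))
    (n := 3 + (ofList l).order + (ofList l).order)
    (T := stateCost z (valueBound l)) (B := valueBound l)
    (fun s hs => bd_outState hk hs (Nat.zero_le _) (Nat.zero_le _) _) (fun s hs => ?_) ?_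
    (fun s hs => ?_)
  · simp only [List.range_zero, List.flatMap_nil, List.append_nil] at this
    refine this.mono (Nat.mul_le_mul_right _ ?_)
    have := length_le_listSize l
    unfold valueBound
    omega
  · simp only [eval, outState]
    omega
  · simp [eval, outState]
  · rw [flatMap_range_succ _ s, ← List.append_assoc]
    exact reaches_stateBody hD hk hz hs _

/-- The cost of the reduction. -/
def reductionCost (z B : ℕ) : ℕ :=
  bitLength 2 + 1 + (B + 1) * ((Expr.sub (.var 0) (.var 1)).size ^ 2 * B + 1 +
      (Prog.seq (.assign 2 (.add (.var 2) (.mul (.get 0 (.var 1)) (.get 0 (.var 1)))))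
        (.assign 1 (.add (.var 1) (.const 1)))).weight * B) +
    (headerProg.weight * B + ((B + 1) * ((Expr.sub (.var 4) (.var 5)).size ^ 2 * B + 1 +
        stateCost z B) + thresholdProg.weight * B))

theorem reaches_reductionProg (h0 : l.getD 0 0 = (ofList l).order) :
    ∃ τ, Reaches (reductionProg z) (initState l) τ (reductionCost z (valueBound l)) ∧
      τ.out = [((3 + (ofList l).order + (ofList l).order : ℕ) : ℤ), 2, 0] ++
        (List.range (3 + (ofList l).order + (ofList l).order)).flatMap (fun s =>
          (List.range 2).flatMap fun a => actionOut (ofList l) z s a) ++ [1, 2] := by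
  refine ⟨_, ((reaches_scaleProg l).mono ?_).seq ((reaches_headerProg h0).seq
    ((reaches_stateLoop hD hk hz _).seq (Prog.LoopFree.reaches (by simp [thresholdProg, LoopFree])
      (bd_outState hk le_rfl (Nat.zero_le _) (Nat.zero_le _) _) rfl))), ?_⟩
  · have : l.length ≤ valueBound l := by
      have := length_le_listSize l
      unfold valueBound
      omega
    gcongr
  · simp [thresholdProg, exec, eval, outState]

end Loops

end LogRAM

/-! ### Encodings of the two kinds of instances -/

theorem length_flatMap_encodeRat {k : ℕ} (f : Fin k → ℚ) :
    ((List.finRange k).flatMap fun i => encodeRat (f i)).length = 2 * k := by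
  simp [List.length_flatMap, encodeRat, mul_comm]

theorem getD_flatMap_encodeRat {k : ℕ} (f : Fin k → ℚ) (l : List ℤ) (j : Fin k) :
    (((List.finRange k).flatMap fun i => encodeRat (f i)) ++ l).getD (2 * j) 0 = (f j).num ∧
      (((List.finRange k).flatMap fun i => encodeRat (f i)) ++ l).getD (2 * j + 1) 0 =
        (f j).den := by
  induction k with
  | zero => exact j.elim0
  | succ k ih =>
    rw [List.finRange_succ, List.flatMap_cons, List.flatMap_map]
    refine Fin.cases ⟨rfl, rfl⟩ (fun i => ?_) j
    exact ih (fun i => f i.succ) i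

theorem flatMap_finRange {α : Type*} {k : ℕ} (f : ℕ → List α) :
    ((List.finRange k).flatMap fun i : Fin k => f i) = (List.range k).flatMap f := by
  induction k generalizing f with
  | zero => rfl
  | succ k ih =>
    rw [List.finRange_succ, List.range_succ_eq_map, List.flatMap_cons, List.flatMap_cons,
      List.flatMap_map, List.flatMap_map]
    exact congrArg _ (ih fun i => f (i + 1))

namespace LRSInstance

open ScaledLRS

variable (I : LRSInstance)

theorem order_ofList_encode : (ofList I.encode).order = I.recurrence.order := rfl

theorem getD_encode_zero : I.encode.getD 0 0 = (ofList I.encode).order := rfl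

theorem length_encode : I.encode.length = 1 + 4 * I.recurrence.order := by
  rw [encode, List.length_cons, List.length_append, length_flatMap_encodeRat,
    length_flatMap_encodeRat]
  omega

theorem coeff_ofList_encode (j : Fin I.recurrence.order) :
    (ofList I.encode).coeffNum j = (I.recurrence.coeffs j).num ∧
      (ofList I.encode).coeffDen j = (I.recurrence.coeffs j).den := by
  have := getD_flatMap_encodeRat I.recurrence.coeffs
    ((List.finRange I.recurrence.order).flatMap (fun i => encodeRat (I.initial i))) j
  simp only [ofList, encode]
  rw [show 1 + 2 * (j : ℕ) = 2 * j + 1 by ring, show 2 + 2 * (j : ℕ) = 2 * j + 1 + 1 by ring,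
    List.getD_cons_succ, List.getD_cons_succ]
  exact this

theorem init_ofList_encode (j : Fin I.recurrence.order) :
    (ofList I.encode).initNum j = (I.initial j).num ∧
      (ofList I.encode).initDen j = (I.initial j).den := by
  have := getD_flatMap_encodeRat I.initial [] j
  rw [List.append_nil] at this
  have hk : (I.encode.getD 0 0).toNat = I.recurrence.order := rfl
  simp only [ofList, hk]
  rw [show 1 + 2 * I.recurrence.order + 2 * (j : ℕ) = 2 * I.recurrence.order + 2 * j + 1 by ring,
    show 2 + 2 * I.recurrence.order + 2 * (j : ℕ) = 2 * I.recurrence.order + (2 * j + 1) + 1 by ring,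
    encode, List.getD_cons_succ, List.getD_cons_succ,
    List.getD_append_right _ _ _ _ (by rw [length_flatMap_encodeRat]; omega),
    List.getD_append_right _ _ _ _ (by rw [length_flatMap_encodeRat]; omega),
    length_flatMap_encodeRat, Nat.add_sub_cancel_left, Nat.add_sub_cancel_left]
  exact this

theorem valid_ofList_encode : (ofList I.encode).Valid where
  order_pos := by
    rw [order_ofList_encode]
    exact two_pos.trans_le I.two_le_order
  coeffDen_pos j hj := by
    rw [(I.coeff_ofList_encode ⟨j, hj⟩).2]
    exact_mod_cast Rat.den_pos _
  initDen_pos j hj := by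
    rw [(I.init_ofList_encode ⟨j, hj⟩).2]
    exact_mod_cast Rat.den_pos _
  abs_coeffNum_lt j _ := abs_getD_lt_scale _ _
  abs_initNum_lt j _ := abs_getD_lt_scale _ _
  one_lt_scale := by
    have : 0 ≤ ∑ j ∈ Finset.range I.encode.length, I.encode.getD j 0 * I.encode.getD j 0 :=
      Finset.sum_nonneg fun j _ => mul_self_nonneg _
    simp only [ofList]
    omega

theorem describes_ofList_encode : (ofList I.encode).Describes I.term where
  init j hj := by
    obtain ⟨h1, h2⟩ := I.init_ofList_encode ⟨j, hj⟩
    rw [h1, h2]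
    exact (I.recurrence.mkSol_eq_init I.initial ⟨j, hj⟩).trans (Rat.num_div_den _).symm
  recurrence n := by
    refine (I.recurrence.is_sol_mkSol I.initial n).trans ?_
    rw [← Fin.sum_univ_eq_sum_range fun j => ((ofList I.encode).coeffNum j : ℚ) /
      (ofList I.encode).coeffDen j * I.term (n + j)]
    refine Finset.sum_congr rfl fun j _ => ?_
    obtain ⟨h1, h2⟩ := I.coeff_ofList_encode j
    rw [h1, h2, Int.cast_natCast, Rat.num_div_den]
    rfl

/-- The Markov decision process with threshold `1 / 2` that is assigned to a sequence. -/
def toThreshold {z : ℕ} (hz : z < 2) : ThresholdInstance where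
  numStates := 3 + (ofList I.encode).order + (ofList I.encode).order
  numActions := 2
  mdp := mdp I.valid_ofList_encode hz
  threshold := 1 / 2
  threshold_pos := by norm_num
  threshold_lt_one := by norm_num

open LogRAM in
-- Brings the encoding into the form in which `reaches_reductionProg` describes the output.
theorem encode_toThreshold {z : ℕ} (hz : z < 2) : (I.toThreshold hz).encode =
    [((3 + (ofList I.encode).order + (ofList I.encode).order : ℕ) : ℤ), 2, 0] ++
      (List.range (3 + (ofList I.encode).order + (ofList I.encode).order)).flatMap (fun s =>
        (List.range 2).flatMap fun a => actionOut (ofList I.encode) z s a) ++ [1, 2] := by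
  have hth : encodeRat (1 / 2) = [1, 2] := by
    simpa using encodeRat_div (n := 1) (d := 2) two_pos
  have hact : ∀ s, (List.range 2).flatMap (fun a => actionOut (ofList I.encode) z s a) =
      (List.finRange 2).flatMap fun a : Fin 2 => actionOut (ofList I.encode) z s a :=
    fun s => (flatMap_finRange _).symm
  have htarget : ∀ s a : ℕ, actionOut (ofList I.encode) z s a = (if s = 0 then 1 else -1) ::
      (List.finRange (3 + (ofList I.encode).order + (ofList I.encode).order)).flatMap
        fun t : Fin (3 + (ofList I.encode).order + (ofList I.encode).order) =>
        encodeRat ((ofList I.encode).entry z s a t) :=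
    fun s a => congrArg _ (flatMap_finRange fun t => encodeRat ((ofList I.encode).entry z s a t)).symm
  simp only [hact]
  rw [← flatMap_finRange]
  simp only [htarget]
  rw [← hth]
  rfl

end LRSInstance

/-! ### Polynomial running time -/

namespace LogRAM

open LRSInstance ScaledLRS

/-- The function `f` is given by a polynomial. -/
def IsPolynomial (f : ℕ → ℕ) : Prop := ∃ p : Polynomial ℕ, ∀ L, p.eval L = f L

theorem IsPolynomial.const (c : ℕ) : IsPolynomial fun _ => c := ⟨.C c, fun _ => by simp⟩

theorem IsPolynomial.id : IsPolynomial fun L => L := ⟨.X, fun _ => by simp⟩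

theorem IsPolynomial.add {f g : ℕ → ℕ} (hf : IsPolynomial f) (hg : IsPolynomial g) :
    IsPolynomial fun L => f L + g L :=
  let ⟨p, hp⟩ := hf
  let ⟨q, hq⟩ := hg
  ⟨p + q, fun L => by simp [hp, hq]⟩

theorem IsPolynomial.mul {f g : ℕ → ℕ} (hf : IsPolynomial f) (hg : IsPolynomial g) :
    IsPolynomial fun L => f L * g L :=
  let ⟨p, hp⟩ := hf
  let ⟨q, hq⟩ := hg
  ⟨p * q, fun L => by simp [hp, hq]⟩

theorem isPolynomial_reductionCost (z : ℕ) :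
    IsPolynomial fun L => reductionCost z (2 * L + 6) := by
  unfold reductionCost stateCost actionCost targetCost
  -- The quantities that depend on the program only are made opaque constants, so that the cost is
  -- visibly built from constants and the variable by sums and products.
  generalize bitLength 2 = c₁
  generalize (Expr.sub (.var 0) (.var 1)).size ^ 2 = c₂
  generalize (Expr.sub (.var 4) (.var 5)).size ^ 2 = c₃
  generalize (Expr.sub (.const 2) (.var 6)).size ^ 2 = c₄
  generalize (Expr.sub (.var 4) (.var 7)).size ^ 2 = c₅
  generalize Prog.weight (.seq (.assign 2 _) _) = c₆
  generalize headerProg.weight = c₇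
  generalize thresholdProg.weight = c₈
  generalize weightProg.weight = c₉
  generalize (entryProg z).weight = c₁₀
  generalize (entryProg z).growth = c₁₁
  generalize setupProg.weight = c₁₂
  generalize setupProg.growth = c₁₃
  generalize finishProg.weight = c₁₄
  generalize nextActionProg.weight = c₁₅
  generalize nextStateProg.weight = c₁₆
  repeat' first
    | exact IsPolynomial.const _
    | exact IsPolynomial.id
    | refine IsPolynomial.add ?_ ?_
    | refine IsPolynomial.mul ?_ ?_

theorem polyTimeComputable_toThreshold {z : ℕ} (hz : z < 2) :
    PolyTimeComputable LRSInstance.encode ThresholdInstance.encode fun I => I.toThreshold hz := by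
  obtain ⟨p, hp⟩ := isPolynomial_reductionCost z
  refine ⟨reductionProg z, p, fun I => ?_⟩
  obtain ⟨τ, ⟨t, h1, h2⟩, h3⟩ := reaches_reductionProg I.valid_ofList_encode
    (by rw [I.length_encode, I.order_ofList_encode]; omega) hz I.getD_encode_zero
  exact ⟨τ, t, h1, h3.trans (I.encode_toThreshold hz).symm, h2.trans_eq (hp _).symm⟩

end LogRAM

/-! ### The two reductions -/

theorem LRSInstance.mem_compl_yes_iff (I : LRSInstance) :
    I ∈ positivityProblem.compl.yes ↔ ∃ n, I.term n < 0 := by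
  change ¬ (∀ n, 0 ≤ I.term n) ↔ _
  push Not
  rfl

theorem cast_half : (((1 / 2 : ℚ) : ℚ) : ℝ) = 1 / 2 := by norm_num

/-- Deciding whether some member of a rational linear recurrence sequence is negative, that is, the
Positivity problem up to exchanging the answers yes and no, is polynomial-time many-one reducible to
the threshold problems for the maximal and for the minimal probability of an energy objective. -/
theorem mainTheorem7 :
    positivityProblem.compl.PolyTimeReducible maxEnergyProblem ∧
      positivityProblem.compl.PolyTimeReducible minEnergyProblem := by
  -- The proof of `z < 2` fixes `z`: `one_lt_two` gives the negative copy for the maximum, and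
  -- `two_pos` the positive copy for the minimum.
  refine ⟨⟨_, LogRAM.polyTimeComputable_toThreshold one_lt_two, fun I => ?_⟩,
    ⟨_, LogRAM.polyTimeComputable_toThreshold two_pos, fun I => ?_⟩⟩
  · refine I.mem_compl_yes_iff.trans (Iff.trans
      (ScaledLRS.half_lt_prMax_iff I.valid_ofList_encode I.describes_ofList_encode).symm ?_)
    rw [← cast_half]
    rfl
  · refine I.mem_compl_yes_iff.trans (Iff.trans
      (ScaledLRS.prMin_lt_half_iff I.valid_ofList_encode I.describes_ofList_encode).symm ?_)
    rw [← cast_half]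
    rfl
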